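/- **Setting.** Let $N_x, m_0, m_1 \ge 1$, $N_2 \ge 2$, $N_1 = (N_2-1)m_1+1$ and $N_0 = (N_1-1)m_0+1$. Let $\Phi_0,\Phi_1,\Phi_2$ be $N_x\times N_x$ matrices that are simultaneously diagonalizable, $\Phi_\ell = U\Lambda_\ell U^{-1}$ with $\Lambda_\ell=\operatorname{diag}(\lambda_{\ell,1},\dots,\lambda_{\ell,N_x})$ (complex eigenvalues) and $|\lambda_{\ell,k}|<1$ for all $\ell,k$. Let $A_\ell$ be the block matrix on $N_\ell$ time points with identity diagonal blocks and $-\Phi_\ell$ on the first block subdiagonal. The C-points of level $\ell\in\{0,1\}$ are the time points whose index is a multiple of $m_\ell$; the others are F-points. Let $P_\ell$ be ideal interpolation (block column $q$ has the blocks $I,\Phi_\ell,\dots,\Phi_\ell^{m_\ell-1}$ in block rows $qm_\ell,\dots,qm_\ell+m_\ell-1$, truncated to $I$ in the last column), $R_\ell$ ideal restriction (block row $q$ has the blocks $\Phi_\ell^{m_\ell-1},\dots,\Phi_\ell,I$ in block columns $qm_\ell-m_\ell+1,\dots,qm_\ell$, truncated to $I$ for $q=0$), $R_{I_0}$ injection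 at the C-points of level $0$, and $S_\ell$ the embedding of the F-point unknowns of level $\ell$. One three-level MGRIT V-cycle with F-relaxation for $A_0u=g$ consists of: F-relaxation $u\leftarrow u+S_0(S_0^TA_0S_0)^{-1}S_0^T(g-A_0u)$; restriction $g_1=R_0(g-A_0u)$; on level 1, starting from $v=0$, F-relaxation for $A_1v=g_1$ followed by $v\leftarrow v+P_1A_2^{-1}R_1(g_1-A_1v)$; and the correction $u\leftarrow u+P_0v$. Let $u_0,u_1,\dots$ be the iterates, $r_i=g-A_0u_i$, and let $c_f=\sup_{i\ge0}\|r_{i+1}\|/\|r_i\|$ (with $0/0=0$), the norm being $\|r\|=\sqrt{r^*(\tilde U\tilde U^*)^{-1}r}$ with $\tilde U$ block diagonal with diagonal blocks $U$. Finally let $$\mathcal E=P_0R_{I_0}-P_0P_1A_2^{-1}R_1R_0A_0P_0R_{I_0}-P_0S_1(S_1^TA_1S_1)^{-1}S_1^TR_0A_0P_0R_{I_0}$$ be the error propagator of the V-cycle, and $\mathcal E_F^{3,\Delta}=R_{I_0}\mathcal E P_0$ the error propagator on level 1, formed for the diagonalized operators (with $\Lambda_\ell$ in place of $\Phi_\ell$).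 **Theorem.** For every right-hand side $g$ and every initial guess $u_0$ whose residual vanishes at the F-points of level $0$ (as it does after F-relaxation), or which is itself the result of a V-cycle (so that all iterations except possibly the first are covered for an arbitrary initial guess), $$c_f\le\sqrt{\|\mathcal E_F^{3,\Delta}\|_1\,\|\mathcal E_F^{3,\Delta}\|_\infty}.$$ If $U$ is unitary, the same bound holds with the $\ell^2$-norm in the definition of $c_f$. Moreover, writing $g_n(z)=\frac{1-|z|^n}{1-|z|}$, $a_k=|\lambda_{1,k}-\lambda_{0,k}^{m_0}|$ and $b_k=|\lambda_{2,k}-\lambda_{0,k}^{m_0}\lambda_{1,k}^{m_1-1}|$, $$\|\mathcal E_F^{3,\Delta}\|_1=\max_{1\le k\le N_x}\ \max_{0\le j\le m_1-1}c_j(k),\qquad \|\mathcal E_F^{3,\Delta}\|_\infty=\max_{1\le k\le N_x}\ \max_{0\le j\le m_1-1}\rho_j(k),$$ where the absolute column sums of the first CF-interval on level 1 are $$c_0(k)=b_k\left(|\lambda_{2,k}|^{N_2-2}+g_{N_2-2}(\lambda_{2,k})\,g_{m_1}(\lambda_{1,k})\right)+a_k\,g_{m_1-1}(\lambda_{1,k}),$$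 $$c_j(k)=|\lambda_{1,k}|^{j-1}a_k\left(|\lambda_{2,k}|^{N_2-2}+g_{N_2-2}(\lambda_{2,k})\,g_{m_1}(\lambda_{1,k})\right)+a_k\,g_{j-1}(\lambda_{1,k}),\quad 1\le j\le m_1-1,$$ and the absolute row sums of the last FC-interval on level 1 are $$\rho_0(k)=b_k\,g_{N_2-1}(\lambda_{2,k})+a_k\,g_{N_2-1}(\lambda_{2,k})\,g_{m_1-1}(\lambda_{1,k}),$$ $$\rho_j(k)=a_k\,g_j(\lambda_{1,k})+|\lambda_{1,k}|^j g_{N_2-2}(\lambda_{2,k})\,b_k+|\lambda_{1,k}|^j g_{N_2-2}(\lambda_{2,k})\,a_k\,g_{m_1-1}(\lambda_{1,k}),\quad 1\le j\le m_1-1.$$ -/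

import Mathlib

open scoped Matrix Kronecker

noncomputable section

namespace MGRIT

/-- Space-time vectors with `N` time points and `Nx` spatial unknowns. -/
abbrev Vec (N Nx : ℕ) : Type := Fin N × Fin Nx → ℂ

/-- Space-time operators, from `M` time points to `N` time points. -/
abbrev Op (N M Nx : ℕ) : Type := Matrix (Fin N × Fin Nx) (Fin M × Fin Nx) ℂ

/-- The operator whose block in block row `i` and block column `j` is `B i j`. -/
def block {N M Nx : ℕ} (B : Fin N → Fin M → Matrix (Fin Nx) (Fin Nx) ℂ) : Op N M Nx :=
  Matrix.of fun p q => B p.1 q.1 p.2 q.2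

/-- The space-time matrix `A` of the one-step method `Φ` on `N` time points: identity blocks on the
diagonal, `-Φ` on the first subdiagonal. -/
def timeMat (N : ℕ) {Nx : ℕ} (Φ : Matrix (Fin Nx) (Fin Nx) ℂ) : Op N N Nx :=
  block fun i j => if i = j then 1 else if (i : ℕ) = j + 1 then -Φ else 0

/-- Ideal restriction from `N` fine to `M` coarse time points, coarsening factor `m`: block row `q`
carries `Φ ^ (m - 1), …, Φ, I` at the fine points `q * m - (m - 1), …, q * m` (only the block `I` at
the fine point `0` when `q = 0`). -/
def idealRestrict (m N M : ℕ) {Nx : ℕ} (Φ : Matrix (Fin Nx) (Fin Nx) ℂ) : Op M N Nx :=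
  block fun q i => if (i : ℕ) ≤ q * m ∧ (q : ℕ) * m < i + m then Φ ^ ((q : ℕ) * m - i) else 0

/-- Ideal interpolation from `M` coarse to `N` fine time points, coarsening factor `m`: block column
`q` carries `I, Φ, …, Φ ^ (m - 1)` at the fine points `q * m, …, q * m + m - 1` (only `I` for the last
coarse point, which is the last fine point). -/
def idealInterp (m N M : ℕ) {Nx : ℕ} (Φ : Matrix (Fin Nx) (Fin Nx) ℂ) : Op N M Nx :=
  block fun i q => if (q : ℕ) * m ≤ i ∧ (i : ℕ) < q * m + m then Φ ^ ((i : ℕ) - q * m) else 0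

/-- Restriction by injection: the value at the C-point `q * m`. -/
def injRestrict (m N M Nx : ℕ) : Op M N Nx :=
  block fun q i => if (i : ℕ) = q * m then 1 else 0

/-- The F-points: the time points whose index is not a multiple of the coarsening factor. -/
abbrev FPoint (m N : ℕ) : Type := {i : Fin N // ¬ m ∣ (i : ℕ)}

/-- The operator `S` that embeds the F-point unknowns into all unknowns. -/
def fEmbed (m N Nx : ℕ) : Matrix (Fin N × Fin Nx) (FPoint m N × Fin Nx) ℂ :=
  Matrix.of fun p q => if p.1 = q.1.1 ∧ p.2 = q.2 then 1 else 0

/-- `S (Sᵀ A S)⁻¹ Sᵀ`: the exact solve on the F-points. -/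
def fSolve (m N : ℕ) {Nx : ℕ} (Φ : Matrix (Fin Nx) (Fin Nx) ℂ) : Op N N Nx :=
  fEmbed m N Nx * ((fEmbed m N Nx)ᵀ * timeMat N Φ * fEmbed m N Nx)⁻¹ * (fEmbed m N Nx)ᵀ

/-- The residual `g - A u`. -/
def residual {N Nx : ℕ} (Φ : Matrix (Fin Nx) (Fin Nx) ℂ) (g u : Vec N Nx) : Vec N Nx :=
  g - timeMat N Φ *ᵥ u

/-- F-relaxation for `A u = g`: all F-points are updated so that their residual vanishes. -/
def fRelax (m : ℕ) {N Nx : ℕ} (Φ : Matrix (Fin Nx) (Fin Nx) ℂ) (g u : Vec N Nx) : Vec N Nx :=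
  u + fSolve m N Φ *ᵥ residual Φ g u

/-- The approximate solve on level 1: starting from zero, F-relaxation followed by a correction that
is restricted to level 2, solved there exactly and interpolated back. -/
def levelOneCycle (m₁ N₁ N₂ : ℕ) {Nx : ℕ} (Φ : Fin 3 → Matrix (Fin Nx) (Fin Nx) ℂ)
    (g : Vec N₁ Nx) : Vec N₁ Nx :=
  let v := fRelax m₁ (Φ 1) g 0
  v + idealInterp m₁ N₁ N₂ (Φ 1) *ᵥ
    ((timeMat N₂ (Φ 2))⁻¹ *ᵥ (idealRestrict m₁ N₁ N₂ (Φ 1) *ᵥ residual (Φ 1) g v))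

/-- One three-level MGRIT V-cycle with F-relaxation for the fine-grid system `A₀ u = g`, applied to
the current iterate `u`. -/
def vCycle (m₀ m₁ N₀ N₁ N₂ : ℕ) {Nx : ℕ} (Φ : Fin 3 → Matrix (Fin Nx) (Fin Nx) ℂ)
    (g u : Vec N₀ Nx) : Vec N₀ Nx :=
  let v := fRelax m₀ (Φ 0) g u
  v + idealInterp m₀ N₀ N₁ (Φ 0) *ᵥ
    levelOneCycle m₁ N₁ N₂ Φ (idealRestrict m₀ N₀ N₁ (Φ 0) *ᵥ residual (Φ 0) g v)

/-- The convergence factor `sup_i ‖r_{i+1}‖ / ‖r_i‖` of the fine-grid residual of the V-cycle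
iteration with initial guess `u`, measured with `nrm`. In `ℝ≥0∞`, `0 / 0 = 0` (the iteration has
already converged) and `x / 0 = ∞` for `x > 0`. -/
def convFactor (m₀ m₁ N₀ N₁ N₂ : ℕ) {Nx : ℕ} (Φ : Fin 3 → Matrix (Fin Nx) (Fin Nx) ℂ)
    (nrm : Vec N₀ Nx → ℝ) (g u : Vec N₀ Nx) : ENNReal :=
  ⨆ i : ℕ, ENNReal.ofReal (nrm (residual (Φ 0) g ((vCycle m₀ m₁ N₀ N₁ N₂ Φ g)^[i + 1] u))) /
    ENNReal.ofReal (nrm (residual (Φ 0) g ((vCycle m₀ m₁ N₀ N₁ N₂ Φ g)^[i] u)))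

/-- The `ℓ²`-norm of a space-time vector. -/
def l2Norm {N Nx : ℕ} (r : Vec N Nx) : ℝ := ‖WithLp.toLp 2 r‖

/-- The `(Ũ Ũ*)⁻¹`-norm `√(r* (Ũ Ũ*)⁻¹ r)`, where `Ũ` is block diagonal with diagonal blocks `U`. -/
def modNorm {N Nx : ℕ} (U : Matrix (Fin Nx) (Fin Nx) ℂ) (r : Vec N Nx) : ℝ :=
  let V : Op N N Nx := (1 : Matrix (Fin N) (Fin N) ℂ) ⊗ₖ U
  √(star r ⬝ᵥ ((V * Vᴴ)⁻¹ *ᵥ r)).re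

/-- The error propagator of the three-level V-cycle with F-relaxation on level 0,
`P₀ R_{I₀} - P₀ P₁ A₂⁻¹ R₁ R₀ A₀ P₀ R_{I₀} - P₀ S₁ (S₁ᵀ A₁ S₁)⁻¹ S₁ᵀ R₀ A₀ P₀ R_{I₀}`. -/
def errProp (m₀ m₁ N₀ N₁ N₂ : ℕ) {Nx : ℕ} (Φ : Fin 3 → Matrix (Fin Nx) (Fin Nx) ℂ) :
    Op N₀ N₀ Nx :=
  let P₀ := idealInterp m₀ N₀ N₁ (Φ 0)
  let P₁ := idealInterp m₁ N₁ N₂ (Φ 1)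
  let R₀ := idealRestrict m₀ N₀ N₁ (Φ 0)
  let R₁ := idealRestrict m₁ N₁ N₂ (Φ 1)
  let RI₀ := injRestrict m₀ N₀ N₁ Nx
  P₀ * RI₀
    - (P₀ * P₁) * (timeMat N₂ (Φ 2))⁻¹ * (R₁ * R₀) * timeMat N₀ (Φ 0) * P₀ * RI₀
    - P₀ * fSolve m₁ N₁ (Φ 1) * R₀ * timeMat N₀ (Φ 0) * P₀ * RI₀

/-- The error propagator on level 1, `R_{I₀} E P₀`. -/
def errPropCoarse (m₀ m₁ N₀ N₁ N₂ : ℕ) {Nx : ℕ} (Φ : Fin 3 → Matrix (Fin Nx) (Fin Nx) ℂ) :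
    Op N₁ N₁ Nx :=
  injRestrict m₀ N₀ N₁ Nx * errProp m₀ m₁ N₀ N₁ N₂ Φ * idealInterp m₀ N₀ N₁ (Φ 0)

/-- The matrix norm `‖·‖₁`: maximum absolute column sum. -/
def normOne {ι : Type*} [Fintype ι] (M : Matrix ι ι ℂ) : ℝ := ⨆ j, ∑ i, ‖M i j‖

/-- The matrix norm `‖·‖_∞`: maximum absolute row sum. -/
def normInf {ι : Type*} [Fintype ι] (M : Matrix ι ι ℂ) : ℝ := ⨆ i, ∑ j, ‖M i j‖

/-- `(1 - |z| ^ n) / (1 - |z|)`. -/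
def geo (z : ℂ) (n : ℕ) : ℝ := (1 - ‖z‖ ^ n) / (1 - ‖z‖)

/-- Absolute column sums of the first CF-interval on level 1 for one mode with eigenvalues
`x, y, z` of `Φ 0, Φ 1, Φ 2`: `j = 0` is the C-point, and `j = 1, …, m₁ - 1` is the F-point
number `m₁ - j`. -/
def colSum (m₀ m₁ N₂ : ℕ) (x y z : ℂ) (j : ℕ) : ℝ :=
  if j = 0 then
    ‖z - x ^ m₀ * y ^ (m₁ - 1)‖ * (‖z‖ ^ (N₂ - 2) + geo z (N₂ - 2) * geo y m₁)
      + ‖y - x ^ m₀‖ * geo y (m₁ - 1)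
  else
    ‖y‖ ^ (j - 1) * ‖y - x ^ m₀‖ * (‖z‖ ^ (N₂ - 2) + geo z (N₂ - 2) * geo y m₁)
      + ‖y - x ^ m₀‖ * geo y (j - 1)

/-- Absolute row sums of the last FC-interval on level 1 for one mode with eigenvalues `x, y, z` of
`Φ 0, Φ 1, Φ 2`: `j = 0` is the last C-point, and `j = 1, …, m₁ - 1` is the `j`-th F-point of the
interval. -/
def rowSum (m₀ m₁ N₂ : ℕ) (x y z : ℂ) (j : ℕ) : ℝ :=
  if j = 0 then
    ‖z - x ^ m₀ * y ^ (m₁ - 1)‖ * geo z (N₂ - 1)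
      + ‖y - x ^ m₀‖ * geo z (N₂ - 1) * geo y (m₁ - 1)
  else
    ‖y - x ^ m₀‖ * geo y j
      + ‖y‖ ^ j * geo z (N₂ - 2) * ‖z - x ^ m₀ * y ^ (m₁ - 1)‖
      + ‖y‖ ^ j * geo z (N₂ - 2) * ‖y - x ^ m₀‖ * geo y (m₁ - 1)

end MGRIT

end

/-!
On level 1 the error propagator is `E = 1 - C A`, where `A` is the step matrix of `Φ₀ ^ m₀` and
`C = P₁ A₂⁻¹ R₁ + S₁ (S₁ᵀ A₁ S₁)⁻¹ S₁ᵀ`, while a residual that lives on the C-points of level 0 is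
propagated by `1 - A C`. For commuting coefficients, reversing time (transposing along the
antidiagonal) fixes `A` and `C` and hence carries `1 - C A` to `1 - A C`: the two propagators have
their row and column sums interchanged. In the eigenbasis `U` the modified norm becomes the
`ℓ²`-norm and the Schur test bounds the residual propagator by `√(‖E‖₁ ‖E‖_∞)`.

Both norms split over the spatial modes. For one mode, splitting `A` into the step matrix of the
level-1 method and a subdiagonal remainder turns `E` into the sum of an F-relaxation defect, which
stays inside one coarsening interval, and a coarse defect, which is propagated by powers of the
level-2 method. The absolute sums are therefore geometric sums; column sums decrease and row sums
increase from one coarsening interval to the next, which is why the first and the last interval,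
respectively, attain the maximum.
-/

namespace MGRIT

section TimeStepping

variable {R : Type*} [Ring R]

/-- The `N × N` matrix with `φ` on the first subdiagonal and zeros elsewhere. -/
def subdiag (N : ℕ) (φ : R) : Matrix (Fin N) (Fin N) R :=
  Matrix.of fun i j => if (i : ℕ) = j + 1 then φ else 0

/-- The space-time matrix of the one-step method `φ`, over the (noncommutative) ring `R` of spatial
operators. -/
def stepMat (N : ℕ) (φ : R) : Matrix (Fin N) (Fin N) R := 1 - subdiag N φ

/-- The inverse of `stepMat N φ`, which propagates data at time `j` to all times `i ≥ j`. -/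
def stepInv (N : ℕ) (φ : R) : Matrix (Fin N) (Fin N) R :=
  Matrix.of fun i j => if (j : ℕ) ≤ i then φ ^ ((i : ℕ) - j) else 0

theorem subdiag_sub (N : ℕ) (φ ψ : R) : subdiag N (φ - ψ) = subdiag N φ - subdiag N ψ := by
  ext i j
  simp only [subdiag, Matrix.of_apply, Matrix.sub_apply]
  split_ifs <;> simp

theorem stepMat_eq_add_subdiag (N : ℕ) (φ ψ : R) :
    stepMat N φ = stepMat N ψ + subdiag N (ψ - φ) := by
  rw [subdiag_sub, stepMat, stepMat]
  abel

/-- Extending the columns to `ℕ`-indexed families avoids a separate case for the first row. -/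
theorem subdiag_mul_of {N : ℕ} {κ : Type*} (φ : R) (x : ℕ → κ → R) (hx : x 0 = 0) :
    subdiag N φ * Matrix.of (fun (i : Fin N) k => x (i + 1) k) =
      Matrix.of fun (i : Fin N) k => φ * x i k := by
  ext ⟨i, hi⟩ k
  cases i with
  | zero => simp [subdiag, Matrix.mul_apply, hx]
  | succ i =>
    rw [Matrix.mul_apply, Fintype.sum_eq_single ⟨i, by omega⟩]
    · simp [subdiag]
    · intro j hj
      simp only [subdiag, Matrix.of_apply, add_left_inj]
      rw [if_neg fun h => hj (Fin.ext h.symm), zero_mul]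

theorem of_mul_subdiag {N : ℕ} {κ : Type*} (φ : R) (x : κ → ℕ → R) (hx : ∀ k, x k N = 0) :
    Matrix.of (fun k (j : Fin N) => x k j) * subdiag N φ =
      Matrix.of fun k (j : Fin N) => x k (j + 1) * φ := by
  ext k j
  rw [Matrix.mul_apply]
  by_cases hj : (j : ℕ) + 1 < N
  · rw [Fintype.sum_eq_single ⟨j + 1, hj⟩]
    · simp [subdiag]
    · intro i hi
      simp only [subdiag, Matrix.of_apply]
      rw [if_neg fun h => hi (Fin.ext h), mul_zero]
  · rw [Matrix.of_apply, show (j : ℕ) + 1 = N by omega, hx, zero_mul]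
    refine Finset.sum_eq_zero fun i _ => ?_
    simp only [subdiag, Matrix.of_apply]
    rw [if_neg (by omega), mul_zero]

theorem stepInv_mul_subdiag (N : ℕ) (φ ψ : R) :
    stepInv N φ * subdiag N ψ =
      Matrix.of fun i j : Fin N => if (j : ℕ) < i then φ ^ ((i : ℕ) - (j + 1)) * ψ else 0 := by
  have h := of_mul_subdiag (N := N) ψ
    (fun (i : Fin N) (j : ℕ) => if j ≤ i then φ ^ ((i : ℕ) - j) else 0)
    fun i => if_neg (by omega)
  simpa only [stepInv, Nat.succ_le_iff, ite_mul, zero_mul] using h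

theorem stepInv_mul_stepMat (N : ℕ) (φ : R) : stepInv N φ * stepMat N φ = 1 := by
  rw [stepMat, mul_sub, mul_one, stepInv_mul_subdiag]
  ext i j
  simp only [stepInv, Matrix.sub_apply, Matrix.of_apply, Matrix.one_apply, ← pow_succ]
  rcases lt_trichotomy i j with h | rfl | h
  · rw [if_neg (by simpa), if_neg (by simpa using h.le), if_neg h.ne, sub_zero]
  · simp
  · rw [if_pos (by simpa using h.le), if_pos (by simpa), if_neg h.ne',
      show (i : ℕ) - (j + 1) + 1 = i - j by omega, sub_self]

theorem subdiag_mul_stepInv (N : ℕ) (φ : R) :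
    subdiag N φ * stepInv N φ = stepInv N φ * subdiag N φ := by
  have h := subdiag_mul_of (N := N) φ
    (fun (i : ℕ) (j : Fin N) => if (j : ℕ) < i then φ ^ (i - (j + 1)) else 0) (by ext; simp)
  rw [stepInv_mul_subdiag]
  simpa only [stepInv, Nat.lt_succ_iff, Nat.add_sub_add_right, mul_ite, mul_zero,
    ← pow_succ, ← pow_succ'] using h

theorem stepMat_mul_stepInv (N : ℕ) (φ : R) : stepMat N φ * stepInv N φ = 1 := by
  rw [stepMat, sub_mul, subdiag_mul_stepInv, one_mul, ← stepInv_mul_stepMat N φ, stepMat, mul_sub,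
    mul_one]

end TimeStepping

section TwoLevel

variable {R : Type*} [Ring R] {m n : ℕ}

/-- The index of the coarsening interval `[p * m, (p + 1) * m)` that contains a fine time point. -/
def interval (i : Fin (n * m + 1)) : Fin (n + 1) :=
  ⟨i / m, Nat.lt_succ_of_le (Nat.div_le_of_le_mul (mul_comm n m ▸ Nat.le_of_lt_succ i.2))⟩

/-- The fine time point `p * m` that is the `p`-th coarse time point. -/
def coarsePoint (m : ℕ) (p : Fin (n + 1)) : Fin (n * m + 1) :=
  ⟨p * m, Nat.lt_succ_of_le (Nat.mul_le_mul_right m (Nat.le_of_lt_succ p.2))⟩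

/-- The matrix whose block row `p` carries `κ 0, …, κ (m - 1)` on the `p`-th coarsening interval. -/
def intervalMat (m n : ℕ) (κ : ℕ → R) : Matrix (Fin (n + 1)) (Fin (n * m + 1)) R :=
  Matrix.of fun p j => if p = interval j then κ (j % m) else 0

/-- Ideal interpolation for the one-step method `φ`. -/
def interpMat (m n : ℕ) (φ : R) : Matrix (Fin (n * m + 1)) (Fin (n + 1)) R :=
  (intervalMat m n (φ ^ ·))ᵀ

/-- Ideal restriction for the one-step method `φ`. -/
def restrictMat (m n : ℕ) (φ : R) : Matrix (Fin (n + 1)) (Fin (n * m + 1)) R :=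
  Matrix.of fun p j => if (j : ℕ) ≤ p * m ∧ (p : ℕ) * m < j + m then φ ^ ((p : ℕ) * m - j) else 0

/-- Injection at the coarse time points. -/
def injMat (R : Type*) [Ring R] (m n : ℕ) : Matrix (Fin (n + 1)) (Fin (n * m + 1)) R :=
  (1 : Matrix (Fin (n * m + 1)) (Fin (n * m + 1)) R).submatrix (coarsePoint m) id

theorem mul_intervalMat_apply {ι : Type*} (X : Matrix ι (Fin (n + 1)) R) (κ : ℕ → R) (i : ι)
    (j : Fin (n * m + 1)) : (X * intervalMat m n κ) i j = X i (interval j) * κ (j % m) := by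
  simp [Matrix.mul_apply, intervalMat]

theorem intervalMat_add (κ κ' : ℕ → R) :
    intervalMat m n (κ + κ') = intervalMat m n κ + intervalMat m n κ' := by
  ext p j
  simp only [intervalMat, Matrix.of_apply, Matrix.add_apply, Pi.add_apply]
  split_ifs <;> simp

theorem interpMat_mul_apply {κ : Type*} (φ : R) (X : Matrix (Fin (n + 1)) κ R)
    (i : Fin (n * m + 1)) (k : κ) :
    (interpMat m n φ * X) i k = φ ^ ((i : ℕ) % m) * X (interval i) k := by
  simp [Matrix.mul_apply, interpMat, intervalMat]

theorem injMat_mul {κ : Type*} (X : Matrix (Fin (n * m + 1)) κ R) :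
    injMat R m n * X = X.submatrix (coarsePoint m) id := by
  ext p k
  simp [Matrix.mul_apply, injMat, Matrix.one_apply]

theorem mul_injMat_transpose {ι : Type*} (X : Matrix ι (Fin (n * m + 1)) R) :
    X * (injMat R m n)ᵀ = X.submatrix id (coarsePoint m) := by
  ext i p
  simp [Matrix.mul_apply, injMat, Matrix.one_apply]

theorem lt_mul_and_mul_le_add_iff (hm : 0 < m) {j p : ℕ} :
    j < p * m ∧ p * m ≤ j + m ↔ p = j / m + 1 := by
  rw [← Nat.div_lt_iff_lt_mul hm, ← Nat.le_div_iff_mul_le hm, Nat.add_div_right j hm]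
  omega

theorem restrictMat_mul_subdiag (φ ψ : R) :
    restrictMat m n φ * subdiag (n * m + 1) ψ =
      Matrix.of fun (p : Fin (n + 1)) (j : Fin (n * m + 1)) =>
        if (j : ℕ) < p * m ∧ (p : ℕ) * m ≤ j + m then φ ^ ((p : ℕ) * m - (j + 1)) * ψ else 0 := by
  have h := of_mul_subdiag (N := n * m + 1) ψ
    (fun (p : Fin (n + 1)) (j : ℕ) =>
      if j ≤ p * m ∧ (p : ℕ) * m < j + m then φ ^ ((p : ℕ) * m - j) else 0)
    fun p => if_neg fun h => (coarsePoint m p).2.not_ge h.1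
  simpa only [restrictMat, Nat.succ_le_iff, Nat.add_right_comm _ 1 m, Nat.lt_succ_iff, ite_mul,
    zero_mul] using h

variable [NeZero m]

theorem interval_coarsePoint (p : Fin (n + 1)) : interval (coarsePoint m p) = p :=
  Fin.ext (Nat.mul_div_cancel _ (NeZero.pos m))

theorem coarsePoint_injective : Function.Injective (coarsePoint (n := n) m) :=
  Function.LeftInverse.injective interval_coarsePoint

theorem coarsePoint_eq_iff {p : Fin (n + 1)} {j : Fin (n * m + 1)} :
    coarsePoint m p = j ↔ p = interval j ∧ (j : ℕ) % m = 0 := by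
  constructor
  · rintro rfl
    exact ⟨(interval_coarsePoint p).symm, Nat.mul_mod_left _ _⟩
  · rintro ⟨rfl, hj⟩
    exact Fin.ext (Nat.div_mul_cancel (Nat.dvd_of_mod_eq_zero hj))

theorem injMat_eq_intervalMat : injMat R m n = intervalMat m n (Pi.single 0 1) := by
  ext p j
  simp only [injMat, intervalMat, Matrix.submatrix_apply, id_eq, Matrix.one_apply,
    Matrix.of_apply, coarsePoint_eq_iff, Pi.single_apply, ite_and]

theorem subdiag_mul_injMat (ψ : R) :
    subdiag (n + 1) ψ * injMat R m n =
      subdiag (n + 1) (1 : R) * intervalMat m n (Pi.single 0 ψ) := by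
  ext p j
  rw [injMat_eq_intervalMat, mul_intervalMat_apply, mul_intervalMat_apply]
  simp only [subdiag, Matrix.of_apply, Pi.single_apply]
  split_ifs <;> simp

theorem injMat_mul_interpMat (φ : R) : injMat R m n * interpMat m n φ = 1 := by
  rw [injMat_mul]
  ext p q
  rw [Matrix.submatrix_apply, id_eq, interpMat, intervalMat, Matrix.transpose_apply,
    Matrix.of_apply, interval_coarsePoint, Matrix.one_apply]
  simp [coarsePoint, eq_comm]

theorem restrictMat_mul_subdiag_eq (φ ψ : R) :
    restrictMat m n φ * subdiag (n * m + 1) ψ =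
      subdiag (n + 1) (1 : R) * intervalMat m n fun r => φ ^ (m - 1 - r) * ψ := by
  ext p j
  have hj := Nat.div_add_mod' j m
  rw [restrictMat_mul_subdiag, mul_intervalMat_apply]
  simp only [Matrix.of_apply, lt_mul_and_mul_le_add_iff (NeZero.pos m), subdiag, interval, ite_mul,
    one_mul, zero_mul]
  refine ite_congr rfl (fun hp => ?_) fun _ => rfl
  rw [hp, Nat.succ_mul, show (j : ℕ) / m * m + m - (j + 1) = m - 1 - j % m by omega]

theorem restrictMat_eq_injMat_add (φ : R) :
    restrictMat m n φ = injMat R m n +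
      subdiag (n + 1) (1 : R) * intervalMat m n
        fun r => if r = 0 then 0 else φ ^ (m - 1 - r) * φ := by
  ext p j
  have hj := Nat.div_add_mod' j m
  have hlt := Nat.mod_lt j (NeZero.pos m)
  have hiff := lt_mul_and_mul_le_add_iff (NeZero.pos m) (j := j) (p := p)
  rw [Matrix.add_apply, mul_intervalMat_apply]
  simp only [restrictMat, injMat, subdiag, Matrix.of_apply, Matrix.submatrix_apply, id_eq,
    Matrix.one_apply, Fin.ext_iff, coarsePoint, interval, ← hiff]
  by_cases hp : (p : ℕ) = j / m + 1
  · have hpm : (p : ℕ) * m = j / m * m + m := by rw [hp, Nat.succ_mul]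
    by_cases h0 : (j : ℕ) % m = 0
    · rw [if_neg (by omega), if_neg (by omega), if_pos h0, mul_zero, add_zero]
    · rw [if_pos (by omega), if_neg (by omega), if_pos (by omega), if_neg h0, one_mul, zero_add,
        ← pow_succ]
      congr 1
      omega
  · rcases eq_or_ne ((p : ℕ) * m) j with hpj | hpj
    · simp [hpj, NeZero.pos m]
    · rw [if_neg (by omega), if_neg hpj, if_neg (by omega), zero_mul, add_zero]

theorem restrictMat_mul_injMat_transpose (φ : R) :
    restrictMat m n φ * (injMat R m n)ᵀ = 1 := by
  rw [mul_injMat_transpose]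
  ext p q
  have h : (q : ℕ) * m ≤ p * m ∧ (p : ℕ) * m < q * m + m ↔ p = q := by
    rw [← Nat.succ_mul, Nat.mul_le_mul_right_iff (NeZero.pos m),
      Nat.mul_lt_mul_right (NeZero.pos m), Fin.ext_iff]
    omega
  simp only [restrictMat, Matrix.submatrix_apply, Matrix.of_apply, id_eq, coarsePoint, h,
    Matrix.one_apply]
  split_ifs with hpq <;> simp [hpq]

theorem restrictMat_mul_stepMat (φ : R) :
    restrictMat m n φ * stepMat (n * m + 1) φ = stepMat (n + 1) (φ ^ m) * injMat R m n := by
  have hκ : (fun r => φ ^ (m - 1 - r) * φ) =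
      (fun r => if r = 0 then 0 else φ ^ (m - 1 - r) * φ) + Pi.single 0 (φ ^ m) := by
    ext r
    rcases eq_or_ne r 0 with rfl | hr
    · simp [pow_sub_one_mul (NeZero.ne m)]
    · simp [hr]
  rw [stepMat, stepMat, Matrix.mul_sub, Matrix.mul_one, Matrix.sub_mul, Matrix.one_mul,
    subdiag_mul_injMat, restrictMat_mul_subdiag_eq, hκ, intervalMat_add, Matrix.mul_add]
  nth_rw 1 [restrictMat_eq_injMat_add]
  abel

theorem interpMat_mul_stepInv (φ : R) :
    interpMat m n φ * stepInv (n + 1) (φ ^ m) = stepInv (n * m + 1) φ * (injMat R m n)ᵀ := by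
  ext i q
  have hi := Nat.mod_add_div' i m
  rw [interpMat_mul_apply, mul_injMat_transpose]
  simp only [stepInv, Matrix.of_apply, Matrix.submatrix_apply, id_eq, interval, coarsePoint,
    Nat.le_div_iff_mul_le (NeZero.pos m), mul_ite, mul_zero, ← pow_mul, ← pow_add]
  refine ite_congr rfl (fun h => ?_) fun _ => rfl
  have hq : (q : ℕ) * m ≤ i / m * m :=
    Nat.mul_le_mul_right m ((Nat.le_div_iff_mul_le (NeZero.pos m)).2 h)
  rw [Nat.mul_sub, mul_comm m, mul_comm m, ← Nat.add_sub_assoc hq, hi]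

theorem stepMat_mul_interpMat (φ : R) :
    stepMat (n * m + 1) φ * interpMat m n φ = (injMat R m n)ᵀ * stepMat (n + 1) (φ ^ m) := by
  calc stepMat (n * m + 1) φ * interpMat m n φ
      = stepMat (n * m + 1) φ * (interpMat m n φ * stepInv (n + 1) (φ ^ m)) *
          stepMat (n + 1) (φ ^ m) := by
        simp only [Matrix.mul_assoc, stepInv_mul_stepMat, Matrix.mul_one]
    _ = (injMat R m n)ᵀ * stepMat (n + 1) (φ ^ m) := by
        rw [interpMat_mul_stepInv, ← Matrix.mul_assoc, stepMat_mul_stepInv, Matrix.one_mul]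

theorem stepInv_mul_restrictMat (φ : R) :
    stepInv (n + 1) (φ ^ m) * restrictMat m n φ = injMat R m n * stepInv (n * m + 1) φ := by
  calc stepInv (n + 1) (φ ^ m) * restrictMat m n φ
      = stepInv (n + 1) (φ ^ m) * (restrictMat m n φ * stepMat (n * m + 1) φ) *
          stepInv (n * m + 1) φ := by
        simp only [Matrix.mul_assoc, stepMat_mul_stepInv, Matrix.mul_one]
    _ = injMat R m n * stepInv (n * m + 1) φ := by
        rw [restrictMat_mul_stepMat, ← Matrix.mul_assoc, stepInv_mul_stepMat, Matrix.one_mul]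

end TwoLevel

section FRelaxation

variable {R : Type*} [Ring R]

/-- The exact solve on the F-points, `S (Sᵀ A S)⁻¹ Sᵀ`. It is encoded as what remains of `A⁻¹` after
the exact coarse-grid correction, so that no inverse of a submatrix is needed over a noncommutative
ring. -/
def fSolveMat (m n : ℕ) (φ : R) : Matrix (Fin (n * m + 1)) (Fin (n * m + 1)) R :=
  stepInv (n * m + 1) φ - interpMat m n φ * stepInv (n + 1) (φ ^ m) * restrictMat m n φ

variable {m n : ℕ} [NeZero m]

theorem injMat_mul_fSolveMat (φ : R) : injMat R m n * fSolveMat m n φ = 0 := by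
  rw [fSolveMat, Matrix.mul_sub, ← stepInv_mul_restrictMat, Matrix.mul_assoc (interpMat _ _ _),
    ← Matrix.mul_assoc, injMat_mul_interpMat, Matrix.one_mul, sub_self]

theorem fSolveMat_mul_injMat_transpose (φ : R) : fSolveMat m n φ * (injMat R m n)ᵀ = 0 := by
  rw [fSolveMat, Matrix.sub_mul, ← interpMat_mul_stepInv, Matrix.mul_assoc,
    restrictMat_mul_injMat_transpose, Matrix.mul_one, sub_self]

theorem stepMat_mul_fSolveMat (φ : R) :
    stepMat (n * m + 1) φ * fSolveMat m n φ = 1 - (injMat R m n)ᵀ * restrictMat m n φ := by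
  rw [fSolveMat, Matrix.mul_sub, stepMat_mul_stepInv, ← Matrix.mul_assoc, ← Matrix.mul_assoc,
    stepMat_mul_interpMat, Matrix.mul_assoc _ (stepMat _ _), stepMat_mul_stepInv, Matrix.mul_one]

theorem fSolveMat_mul_stepMat (φ : R) :
    fSolveMat m n φ * stepMat (n * m + 1) φ = 1 - interpMat m n φ * injMat R m n := by
  rw [fSolveMat, Matrix.sub_mul, stepInv_mul_stepMat, Matrix.mul_assoc, restrictMat_mul_stepMat,
    Matrix.mul_assoc, ← Matrix.mul_assoc (stepInv _ _), stepInv_mul_stepMat, Matrix.one_mul]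

theorem fSolveMat_mul_subdiag (φ ψ : R) :
    fSolveMat m n φ * subdiag (n * m + 1) ψ =
      Matrix.of fun i j : Fin (n * m + 1) =>
        if interval i = interval j ∧ (j : ℕ) % m < i % m then
          φ ^ ((i : ℕ) % m - (j % m + 1)) * ψ else 0 := by
  ext i j
  have hi := Nat.div_add_mod' i m
  have hj := Nat.div_add_mod' j m
  have hjm := Nat.mod_lt j (NeZero.pos m)
  rw [fSolveMat, Matrix.sub_mul, Matrix.mul_assoc, restrictMat_mul_subdiag_eq, Matrix.mul_assoc,
    ← Matrix.mul_assoc (stepInv _ _), Matrix.sub_apply, interpMat_mul_apply, mul_intervalMat_apply,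
    stepInv_mul_subdiag, stepInv_mul_subdiag]
  simp only [Matrix.of_apply, interval, Fin.mk.injEq, mul_one]
  rcases lt_trichotomy ((j : ℕ) / m) (i / m) with h | h | h
  · have hlt : (j : ℕ) < i := Nat.lt_of_div_lt_div h
    obtain ⟨d, hd⟩ := Nat.exists_eq_add_of_lt h
    have hexp : (i : ℕ) - (j + 1) = i % m + m * (i / m - (j / m + 1)) + (m - 1 - j % m) := by
      have : (i : ℕ) / m * m = j / m * m + d * m + m := by rw [hd]; ring
      rw [hd, show (j : ℕ) / m + d + 1 - (j / m + 1) = d by omega, mul_comm m d]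
      omega
    rw [if_pos hlt, if_pos h, if_neg fun hij => h.ne hij.1.symm, ← mul_assoc,
      ← mul_assoc, ← pow_mul, ← pow_add, ← pow_add, ← hexp, sub_self]
  · rw [h] at hj
    rw [if_neg h.not_lt, zero_mul, mul_zero, sub_zero]
    refine ite_congr (by rw [eq_iff_iff]; omega) (fun _ => ?_) fun _ => rfl
    rw [show (i : ℕ) - (j + 1) = i % m - (j % m + 1) by omega]
  · have hlt : (i : ℕ) < j := Nat.lt_of_div_lt_div h
    simp [h.not_gt, h.ne, hlt.not_gt]

end FRelaxation

section ErrorPropagator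

variable {R : Type*} [Ring R]

/-- The approximate inverse of `A₁` realized by the two-level cycle with F-relaxation whose coarse
problem has the propagator `z` instead of `y ^ m`. -/
def coarseSolve (m n : ℕ) (y z : R) : Matrix (Fin (n * m + 1)) (Fin (n * m + 1)) R :=
  interpMat m n y * stepInv (n + 1) z * restrictMat m n y + fSolveMat m n y

/-- The level-1 error propagator of the three-level V-cycle, where `w` is the propagator of the
exact level-1 problem, and `y` and `z` are the propagators used on levels 1 and 2. -/
def errMat (m n : ℕ) (w y z : R) : Matrix (Fin (n * m + 1)) (Fin (n * m + 1)) R :=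
  1 - coarseSolve m n y z * stepMat (n * m + 1) w

/-- The residual propagator that corresponds to `errMat`. -/
def resMat (m n : ℕ) (w y z : R) : Matrix (Fin (n * m + 1)) (Fin (n * m + 1)) R :=
  1 - stepMat (n * m + 1) w * coarseSolve m n y z

/-- The defect, seen at the next coarse point, of an initial value at position `r` of a coarsening
interval. At `r = 0` the level-2 propagator `z` competes with `y ^ (m - 1) * w`. -/
def coupling (m : ℕ) (w y z : R) : ℕ → R :=
  Pi.single 0 (z - y ^ m) + fun r => y ^ (m - 1 - r) * (y - w)

variable {m n : ℕ} [NeZero m]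

theorem coupling_zero (w y z : R) : coupling m w y z 0 = z - y ^ (m - 1) * w := by
  simp [coupling, mul_sub, pow_sub_one_mul (NeZero.ne m)]

theorem coarseSolve_mul_stepMat (y z : R) :
    coarseSolve m n y z * stepMat (n * m + 1) y =
      1 + interpMat m n y * (stepInv (n + 1) z * subdiag (n + 1) 1 *
        intervalMat m n (Pi.single 0 (z - y ^ m))) := by
  have hT : stepInv (n + 1) z * stepMat (n + 1) (y ^ m) =
      1 + stepInv (n + 1) z * subdiag (n + 1) (z - y ^ m) := by
    rw [stepMat_eq_add_subdiag _ _ z, mul_add, stepInv_mul_stepMat]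
  rw [coarseSolve, Matrix.add_mul, fSolveMat_mul_stepMat, Matrix.mul_assoc, restrictMat_mul_stepMat,
    Matrix.mul_assoc, ← Matrix.mul_assoc (stepInv _ _), hT, Matrix.add_mul, Matrix.one_mul,
    Matrix.mul_assoc (stepInv _ _), subdiag_mul_injMat, Matrix.mul_add]
  simp only [Matrix.mul_assoc]
  abel

/-- Relative to the level-1 propagator `y`, the exact propagator `w` perturbs the F-solve by
`y - w`; everything else has to cross a coarse point. -/
theorem errMat_eq (w y z : R) :
    errMat m n w y z = -(fSolveMat m n y * subdiag (n * m + 1) (y - w) +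
      interpMat m n y * (stepInv (n + 1) z * subdiag (n + 1) 1 *
        intervalMat m n (coupling m w y z))) := by
  rw [errMat, stepMat_eq_add_subdiag _ w y, Matrix.mul_add, coarseSolve_mul_stepMat, coarseSolve,
    Matrix.add_mul, Matrix.mul_assoc _ (restrictMat _ _ _), restrictMat_mul_subdiag_eq, coupling,
    intervalMat_add]
  simp only [Matrix.mul_add, Matrix.mul_assoc]
  abel

theorem errMat_apply (w y z : R) (i j : Fin (n * m + 1)) :
    errMat m n w y z i j =
      -((if (i : ℕ) / m = j / m ∧ (j : ℕ) % m < i % m then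
          y ^ ((i : ℕ) % m - (j % m + 1)) * (y - w) else 0) +
        if (j : ℕ) / m < i / m then
          y ^ ((i : ℕ) % m) * (z ^ ((i : ℕ) / m - (j / m + 1)) * coupling m w y z (j % m))
        else 0) := by
  rw [errMat_eq, Matrix.neg_apply, Matrix.add_apply, fSolveMat_mul_subdiag, interpMat_mul_apply,
    mul_intervalMat_apply, stepInv_mul_subdiag]
  simp only [Matrix.of_apply, mul_one, ite_mul, mul_ite, zero_mul, mul_zero, interval, Fin.mk.injEq]

end ErrorPropagator

section TimeReversal

variable {R : Type*} {M N : ℕ}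

/-- Transposition across the antidiagonal, which is the reversal of time. -/
def antiTranspose (X : Matrix (Fin M) (Fin N) R) : Matrix (Fin N) (Fin M) R :=
  Xᵀ.submatrix Fin.rev Fin.rev

theorem antiTranspose_antiTranspose (X : Matrix (Fin M) (Fin N) R) :
    antiTranspose (antiTranspose X) = X := by
  ext i j
  simp [antiTranspose]

variable [CommRing R]

theorem antiTranspose_mul {K : ℕ} (X : Matrix (Fin M) (Fin N) R) (Y : Matrix (Fin N) (Fin K) R) :
    antiTranspose (X * Y) = antiTranspose Y * antiTranspose X := by
  rw [antiTranspose, Matrix.transpose_mul]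
  exact (Matrix.submatrix_mul_equiv _ _ Fin.rev Fin.revPerm Fin.rev).symm

theorem antiTranspose_one : antiTranspose (1 : Matrix (Fin N) (Fin N) R) = 1 := by
  ext i j
  simp [antiTranspose, Matrix.one_apply]

theorem antiTranspose_add (X Y : Matrix (Fin M) (Fin N) R) :
    antiTranspose (X + Y) = antiTranspose X + antiTranspose Y := rfl

theorem antiTranspose_sub (X Y : Matrix (Fin M) (Fin N) R) :
    antiTranspose (X - Y) = antiTranspose X - antiTranspose Y := rfl

theorem antiTranspose_subdiag (φ : R) : antiTranspose (subdiag N φ) = subdiag N φ := by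
  ext i j
  refine if_congr ?_ rfl rfl
  simp only [Fin.val_rev]
  omega

theorem antiTranspose_stepMat (φ : R) : antiTranspose (stepMat N φ) = stepMat N φ := by
  rw [stepMat, antiTranspose_sub, antiTranspose_one, antiTranspose_subdiag]

theorem antiTranspose_stepInv (φ : R) : antiTranspose (stepInv N φ) = stepInv N φ := by
  ext i j
  simp only [antiTranspose, stepInv, Matrix.submatrix_apply, Matrix.transpose_apply,
    Matrix.of_apply, Fin.val_rev]
  refine ite_congr (by rw [eq_iff_iff]; omega) (fun h => ?_) fun _ => rfl
  congr 1
  omega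

variable {m n : ℕ} [NeZero m]

theorem antiTranspose_restrictMat (φ : R) :
    antiTranspose (restrictMat m n φ) = interpMat m n φ := by
  ext i p
  have hi := Nat.div_add_mod' i m
  have hlt := Nat.mod_lt i (NeZero.pos m)
  have hrev : (n + 1 - (p + 1)) * m = n * m - p * m := by rw [Nat.add_sub_add_right, Nat.sub_mul]
  have hiff : (p : ℕ) = i / m ↔ (p : ℕ) * m ≤ i ∧ (i : ℕ) < p * m + m := by
    rw [eq_comm, Nat.div_eq_iff (NeZero.pos m)]
    omega
  simp only [antiTranspose, restrictMat, interpMat, intervalMat, Matrix.submatrix_apply,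
    Matrix.transpose_apply, Matrix.of_apply, Fin.val_rev, Fin.ext_iff, interval, hrev, hiff]
  have hp := Nat.le_of_lt_succ (coarsePoint m p).2
  simp only [coarsePoint] at hp
  refine ite_congr (by rw [eq_iff_iff]; omega) (fun h => ?_) fun _ => rfl
  have hpi : (p : ℕ) * m = i / m * m := by rw [hiff.2 h]
  congr 1
  omega

theorem antiTranspose_interpMat (φ : R) :
    antiTranspose (interpMat m n φ) = restrictMat m n φ := by
  rw [← antiTranspose_restrictMat, antiTranspose_antiTranspose]

theorem antiTranspose_coarseSolve (y z : R) :
    antiTranspose (coarseSolve m n y z) = coarseSolve m n y z := by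
  simp only [coarseSolve, fSolveMat, antiTranspose_add, antiTranspose_sub, antiTranspose_mul,
    antiTranspose_interpMat, antiTranspose_restrictMat, antiTranspose_stepInv, Matrix.mul_assoc]

theorem antiTranspose_errMat (w y z : R) :
    antiTranspose (errMat m n w y z) = resMat m n w y z := by
  rw [errMat, antiTranspose_sub, antiTranspose_one, antiTranspose_mul, antiTranspose_stepMat,
    antiTranspose_coarseSolve, resMat]

end TimeReversal

section RingHom

variable {R S : Type*} [Ring R] [Ring S] (f : R →+* S) (m n N : ℕ)

theorem map_subdiag (φ : R) : (subdiag N φ).map f = subdiag N (f φ) := by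
  ext i j
  simp [subdiag, apply_ite f]

theorem map_stepMat (φ : R) : (stepMat N φ).map f = stepMat N (f φ) := by
  rw [stepMat, Matrix.map_sub f (map_sub f), map_subdiag, Matrix.map_one f (map_zero f) (map_one f),
    stepMat]

theorem map_stepInv (φ : R) : (stepInv N φ).map f = stepInv N (f φ) := by
  ext i j
  simp [stepInv, apply_ite f]

theorem map_interpMat (φ : R) : (interpMat m n φ).map f = interpMat m n (f φ) := by
  ext i j
  simp [interpMat, intervalMat, apply_ite f]

theorem map_restrictMat (φ : R) : (restrictMat m n φ).map f = restrictMat m n (f φ) := by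
  ext i j
  simp [restrictMat, apply_ite f]

theorem map_coarseSolve (y z : R) :
    (coarseSolve m n y z).map f = coarseSolve m n (f y) (f z) := by
  simp only [coarseSolve, fSolveMat, Matrix.map_add f (map_add f), Matrix.map_sub f (map_sub f),
    Matrix.map_mul, map_interpMat, map_restrictMat, map_stepInv, map_pow]

theorem map_errMat (w y z : R) :
    (errMat m n w y z).map f = errMat m n (f w) (f y) (f z) := by
  rw [errMat, Matrix.map_sub f (map_sub f), Matrix.map_one f (map_zero f) (map_one f),
    Matrix.map_mul, map_coarseSolve, map_stepMat, errMat]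

theorem map_resMat (w y z : R) :
    (resMat m n w y z).map f = resMat m n (f w) (f y) (f z) := by
  rw [resMat, Matrix.map_sub f (map_sub f), Matrix.map_one f (map_zero f) (map_one f),
    Matrix.map_mul, map_coarseSolve, map_stepMat, resMat]

end RingHom

section GeometricSums

theorem geo_eq_sum {z : ℂ} (hz : ‖z‖ ≠ 1) (n : ℕ) : geo z n = ∑ k ∈ Finset.range n, ‖z‖ ^ k := by
  rw [geom_sum_eq hz, geo, ← neg_sub (‖z‖ ^ n), ← neg_sub ‖z‖, neg_div_neg_eq]

theorem geo_zero (z : ℂ) : geo z 0 = 0 := by simp [geo]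

theorem geo_nonneg {z : ℂ} (hz : ‖z‖ ≠ 1) (n : ℕ) : 0 ≤ geo z n := by
  rw [geo_eq_sum hz]
  positivity

theorem geo_mono {z : ℂ} (hz : ‖z‖ ≠ 1) : Monotone (geo z) := fun a b h => by
  rw [geo_eq_sum hz, geo_eq_sum hz]
  exact Finset.sum_le_sum_of_subset_of_nonneg (Finset.range_mono h) fun _ _ _ => by positivity

theorem geo_succ {z : ℂ} (hz : ‖z‖ ≠ 1) (n : ℕ) : geo z (n + 1) = geo z n + ‖z‖ ^ n := by
  rw [geo_eq_sum hz, geo_eq_sum hz, Finset.sum_range_succ]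

theorem one_le_geo {z : ℂ} (hz : ‖z‖ ≠ 1) {n : ℕ} (hn : n ≠ 0) : 1 ≤ geo z n :=
  calc 1 = geo z 1 := by simp [geo_eq_sum hz]
    _ ≤ geo z n := geo_mono hz (Nat.one_le_iff_ne_zero.2 hn)

theorem monotone_pow_add_geo_mul {z : ℂ} (hz : ‖z‖ ≠ 1) {c : ℝ} (hc : 1 ≤ c) :
    Monotone fun d => ‖z‖ ^ d + geo z d * c := by
  refine monotone_nat_of_le_succ fun d => ?_
  rw [geo_succ hz]
  have hd : ‖z‖ ^ d ≤ ‖z‖ ^ d * c := le_mul_of_one_le_right (by positivity) hc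
  have hd' : 0 ≤ ‖z‖ ^ (d + 1) := by positivity
  linarith

theorem sum_range_ite_lt_pow {z : ℂ} (hz : ‖z‖ ≠ 1) (n b : ℕ) :
    ∑ a ∈ Finset.range n, (if b < a then ‖z‖ ^ (a - (b + 1)) else 0) = geo z (n - 1 - b) := by
  rw [geo_eq_sum hz, ← Finset.sum_filter]
  have hfilter : Finset.filter (b < ·) (Finset.range n) = Finset.Ico (b + 1) n := by
    ext a
    simp only [Finset.mem_filter, Finset.mem_range, Finset.mem_Ico]
    omega
  rw [hfilter, Finset.sum_Ico_eq_sum_range]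
  simp only [Nat.add_sub_cancel_left, Nat.sub_sub, Nat.add_comm 1]

theorem sum_range_ite_gt_pow {z : ℂ} (hz : ‖z‖ ≠ 1) {n a : ℕ} (ha : a ≤ n) :
    ∑ b ∈ Finset.range n, (if b < a then ‖z‖ ^ (a - (b + 1)) else 0) = geo z a := by
  rw [geo_eq_sum hz, ← Finset.sum_filter]
  have hfilter : Finset.filter (· < a) (Finset.range n) = Finset.range a := by
    ext b
    simp only [Finset.mem_filter, Finset.mem_range]
    omega
  rw [hfilter, ← Finset.sum_range_reflect]
  refine Finset.sum_congr rfl fun k hk => ?_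
  have hka := Finset.mem_range.1 hk
  rw [show a - (a - 1 - k + 1) = k by omega]

theorem sum_div_mod {M : Type*} [AddCommMonoid M] (m n : ℕ) [NeZero m] (f : ℕ → ℕ → M) :
    ∑ i : Fin (n * m + 1), f (i / m) (i % m) =
      ∑ q ∈ Finset.range n, ∑ a ∈ Finset.range m, f q a + f n 0 := by
  have hm := NeZero.pos m
  rw [Fin.sum_univ_castSucc, ← finProdFinEquiv.sum_comp, Fintype.sum_prod_type, Finset.sum_range]
  simp [Finset.sum_range, Nat.add_mul_div_left, Nat.div_eq_of_lt, Nat.mod_eq_of_lt, hm]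

end GeometricSums

section Mode

theorem iSup_eq_iSup_of_forall_exists_le {ι κ : Type*} {f : ι → ℝ} {g : κ → ℝ}
    (hfg : ∀ i, ∃ k, f i ≤ g k) (hgf : ∀ k, ∃ i, g k ≤ f i) : ⨆ i, f i = ⨆ k, g k :=
  csSup_eq_csSup_of_forall_exists_le (by simpa using hfg) (by simpa using hgf)

variable {m n : ℕ} {w y z : ℂ}

theorem norm_coupling_of_pos {r : ℕ} (hr : r ≠ 0) :
    ‖coupling m w y z r‖ = ‖y‖ ^ (m - 1 - r) * ‖y - w‖ := by
  simp [coupling, hr]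

theorem mod_eq_zero_of_le_div (i : Fin (n * m + 1)) (hi : n ≤ (i : ℕ) / m) : (i : ℕ) % m = 0 := by
  have hdiv := Nat.div_add_mod' i m
  have hle := Nat.mul_le_mul_right m hi
  omega

theorem rowSum_zero {m₀ : ℕ} {x : ℂ} :
    rowSum m₀ m (n + 1) x y z 0 =
      geo z n * (‖z - x ^ m₀ * y ^ (m - 1)‖ + ‖y - x ^ m₀‖ * geo y (m - 1)) := by
  rw [rowSum, if_pos rfl, Nat.add_sub_cancel]
  ring

theorem rowSum_of_ne_zero {m₀ : ℕ} {x : ℂ} {a : ℕ} (ha : a ≠ 0) :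
    rowSum m₀ m (n + 1) x y z a =
      ‖y - x ^ m₀‖ * geo y a + ‖y‖ ^ a * geo z (n - 1) *
        (‖z - x ^ m₀ * y ^ (m - 1)‖ + ‖y - x ^ m₀‖ * geo y (m - 1)) := by
  rw [rowSum, if_neg ha, show n + 1 - 2 = n - 1 by omega]
  ring

variable [NeZero m]

theorem norm_errMat_apply (i j : Fin (n * m + 1)) :
    ‖errMat m n w y z i j‖ =
      (if (i : ℕ) / m = j / m then
        (if (j : ℕ) % m < i % m then ‖y‖ ^ ((i : ℕ) % m - (j % m + 1)) else 0) * ‖y - w‖ else 0) +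
      (if (j : ℕ) / m < i / m then ‖z‖ ^ ((i : ℕ) / m - (j / m + 1)) else 0) *
        (‖y‖ ^ ((i : ℕ) % m) * ‖coupling m w y z (j % m)‖) := by
  rw [errMat_apply, norm_neg]
  rcases lt_trichotomy ((j : ℕ) / m) (i / m) with h | h | h
  · rw [if_neg fun hij => h.ne hij.1.symm]
    simp [h, h.ne', mul_left_comm]
  · simp only [h, lt_irrefl, if_false, true_and, if_true, add_zero, zero_mul]
    split_ifs <;> simp
  · simp [h.ne, h.not_gt]

theorem sum_norm_coupling (hy : ‖y‖ ≠ 1) :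
    ∑ r ∈ Finset.range m, ‖coupling m w y z r‖ =
      ‖z - w * y ^ (m - 1)‖ + ‖y - w‖ * geo y (m - 1) := by
  obtain ⟨m, rfl⟩ := Nat.exists_eq_succ_of_ne_zero (NeZero.ne m)
  rw [Finset.sum_range_succ', coupling_zero, add_comm, mul_comm w, Nat.succ_sub_one, geo_eq_sum hy,
    Finset.mul_sum, ← Finset.sum_range_reflect (fun k => ‖y - w‖ * ‖y‖ ^ k)]
  congr 1
  refine Finset.sum_congr rfl fun r _ => ?_
  rw [norm_coupling_of_pos r.succ_ne_zero, mul_comm, Nat.succ_sub_one, Nat.sub_sub, Nat.add_comm 1]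

theorem sum_norm_errMat_col (hy : ‖y‖ ≠ 1) (hz : ‖z‖ ≠ 1) (j : Fin (n * m + 1))
    (hj : (j : ℕ) / m < n) :
    ∑ i, ‖errMat m n w y z i j‖ =
      ‖coupling m w y z (j % m)‖ *
          (‖z‖ ^ (n - 1 - j / m) + geo z (n - 1 - j / m) * geo y m) +
        ‖y - w‖ * geo y (m - 1 - j % m) := by
  simp only [norm_errMat_apply]
  rw [sum_div_mod m n fun q a => (if q = (j : ℕ) / m then
        (if (j : ℕ) % m < a then ‖y‖ ^ (a - (j % m + 1)) else 0) * ‖y - w‖ else 0) +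
      (if (j : ℕ) / m < q then ‖z‖ ^ (q - (j / m + 1)) else 0) *
        (‖y‖ ^ a * ‖coupling m w y z (j % m)‖)]
  simp only [Finset.sum_add_distrib, ← Finset.mul_sum, ← Finset.sum_mul, Finset.sum_ite_irrel,
    Finset.sum_const_zero, Finset.sum_ite_eq', Finset.mem_range, hj, if_true,
    sum_range_ite_lt_pow hy, sum_range_ite_lt_pow hz, ← geo_eq_sum hy]
  rw [if_neg (by omega), show n - ((j : ℕ) / m + 1) = n - 1 - j / m by omega]
  ring

theorem norm_errMat_apply_of_le_div (i j : Fin (n * m + 1)) (hj : n ≤ (j : ℕ) / m) :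
    ‖errMat m n w y z i j‖ = 0 := by
  have hi : (i : ℕ) / m ≤ j / m := (Nat.le_of_lt_succ (interval i).2).trans hj
  rw [norm_errMat_apply, if_neg hi.not_gt, zero_mul, add_zero]
  split_ifs with h hlt
  · rw [mod_eq_zero_of_le_div i (h ▸ hj)] at hlt
    exact absurd hlt (Nat.not_lt_zero _)
  all_goals simp

theorem sum_norm_errMat_row (hy : ‖y‖ ≠ 1) (hz : ‖z‖ ≠ 1) (i : Fin (n * m + 1)) :
    ∑ j, ‖errMat m n w y z i j‖ =
      ‖y - w‖ * geo y (i % m) + ‖y‖ ^ ((i : ℕ) % m) * geo z (i / m) *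
        (‖z - w * y ^ (m - 1)‖ + ‖y - w‖ * geo y (m - 1)) := by
  have hle : (i : ℕ) / m ≤ n := Nat.le_of_lt_succ (interval i).2
  have hmod := (Nat.mod_lt i (NeZero.pos m)).le
  simp only [norm_errMat_apply]
  rw [sum_div_mod m n fun p r => (if (i : ℕ) / m = p then
        (if r < (i : ℕ) % m then ‖y‖ ^ ((i : ℕ) % m - (r + 1)) else 0) * ‖y - w‖ else 0) +
      (if p < (i : ℕ) / m then ‖z‖ ^ ((i : ℕ) / m - (p + 1)) else 0) *
        (‖y‖ ^ ((i : ℕ) % m) * ‖coupling m w y z r‖)]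
  simp only [Finset.sum_add_distrib, ← Finset.mul_sum, ← Finset.sum_mul, Finset.sum_ite_irrel,
    Finset.sum_const_zero, Finset.sum_ite_eq, Finset.mem_range, sum_norm_coupling hy,
    sum_range_ite_gt_pow hy hmod, sum_range_ite_gt_pow hz hle, if_neg hle.not_gt]
  rcases hle.lt_or_eq with h | h
  · rw [if_pos h, if_neg h.ne]
    ring
  · simp only [h, lt_irrefl, mod_eq_zero_of_le_div i h.ge, if_false, geo_zero]
    simp

theorem colSum_eq {m₀ : ℕ} {x : ℂ} {b : ℕ} (hb : b < m) :
    colSum m₀ m (n + 1) x y z b =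
      ‖coupling m (x ^ m₀) y z ((m - b) % m)‖ * (‖z‖ ^ (n - 1) + geo z (n - 1) * geo y m) +
        ‖y - x ^ m₀‖ * geo y (m - 1 - (m - b) % m) := by
  rw [colSum, show n + 1 - 2 = n - 1 by omega]
  split_ifs with h
  · rw [h, Nat.sub_zero, Nat.mod_self, coupling_zero, mul_comm (y ^ _), Nat.sub_zero]
  · rw [Nat.mod_eq_of_lt (by omega), norm_coupling_of_pos (by omega),
      show m - 1 - (m - b) = b - 1 by omega]

theorem normOne_errMat {m₀ : ℕ} {x : ℂ} (hy : ‖y‖ ≠ 1) (hz : ‖z‖ ≠ 1) (hn : n ≠ 0) :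
    normOne (errMat m n (x ^ m₀) y z) = ⨆ b : Fin m, colSum m₀ m (n + 1) x y z b := by
  have hm := NeZero.pos m
  refine iSup_eq_iSup_of_forall_exists_le (fun j => ?_) fun b => ?_
  · have hb : (m - (j : ℕ) % m) % m < m := Nat.mod_lt _ hm
    have hr : (m - (m - (j : ℕ) % m) % m) % m = j % m := by
      have hlt := Nat.mod_lt j hm
      rcases Nat.eq_zero_or_pos ((j : ℕ) % m) with h | h
      · simp [h]
      · rw [Nat.mod_eq_of_lt (Nat.sub_lt hm h), Nat.sub_sub_self hlt.le, Nat.mod_mod]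
    refine ⟨⟨_, hb⟩, ?_⟩
    rw [colSum_eq hb, hr]
    have hmono := monotone_pow_add_geo_mul hz (one_le_geo hy (NeZero.ne m))
    have hgeo := geo_nonneg hz (n - 1)
    have hgeo' := geo_nonneg hy
    rcases lt_or_ge ((j : ℕ) / m) n with hj | hj
    · rw [sum_norm_errMat_col hy hz j hj]
      gcongr ‖coupling _ _ _ _ _‖ * ?_ + _
      exact hmono (Nat.sub_le _ _)
    · simp only [norm_errMat_apply_of_le_div _ j hj, Finset.sum_const_zero]
      have := hgeo' m
      have := hgeo' (m - 1 - j % m)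
      positivity
  · have hr : (m - (b : ℕ)) % m < m := Nat.mod_lt _ hm
    have hle : m ≤ n * m := Nat.le_mul_of_pos_left m (Nat.pos_of_ne_zero hn)
    refine ⟨⟨(m - b) % m, by omega⟩, ?_⟩
    rw [colSum_eq b.2, sum_norm_errMat_col hy hz _ (by simpa [hm] using Nat.pos_of_ne_zero hn)]
    simp only [Nat.div_eq_of_lt hr, Nat.mod_eq_of_lt hr, Nat.sub_zero, le_refl]

theorem normInf_errMat {m₀ : ℕ} {x : ℂ} (hy : ‖y‖ ≠ 1) (hz : ‖z‖ ≠ 1) (hn : n ≠ 0) :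
    normInf (errMat m n (x ^ m₀) y z) = ⨆ a : Fin m, rowSum m₀ m (n + 1) x y z a := by
  have hm := NeZero.pos m
  have hgeo := geo_nonneg hy (m - 1)
  refine iSup_eq_iSup_of_forall_exists_le (fun i => ⟨⟨i % m, Nat.mod_lt _ hm⟩, ?_⟩) fun a => ?_
  · rw [sum_norm_errMat_row hy hz]
    rcases eq_or_ne ((i : ℕ) % m) 0 with ha | ha
    · simp only [ha, rowSum_zero, pow_zero, one_mul, geo_zero, mul_zero, zero_add]
      gcongr
      exact geo_mono hz (Nat.le_of_lt_succ (interval i).2)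
    · have hi : (i : ℕ) / m ≤ n - 1 :=
        Nat.le_sub_one_of_lt (lt_of_not_ge fun h => ha (mod_eq_zero_of_le_div i h))
      rw [rowSum_of_ne_zero ha]
      gcongr
      exact geo_mono hz hi
  · rcases eq_or_ne (a : ℕ) 0 with ha | ha
    · refine ⟨⟨n * m, Nat.lt_succ_self _⟩, ?_⟩
      rw [sum_norm_errMat_row hy hz, ha, rowSum_zero]
      simp [hm, geo_zero]
    · have hlt : (n - 1) * m + a < n * m + 1 := by
        obtain ⟨n, rfl⟩ := Nat.exists_eq_succ_of_ne_zero hn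
        rw [Nat.succ_sub_one, Nat.succ_mul]
        omega
      have hdiv : ((n - 1) * m + a) / m = n - 1 := by
        rw [mul_comm, Nat.mul_add_div hm, Nat.div_eq_of_lt a.2, add_zero]
      refine ⟨⟨(n - 1) * m + a, hlt⟩, ?_⟩
      rw [sum_norm_errMat_row hy hz, rowSum_of_ne_zero ha]
      simp only [hdiv, Nat.mul_add_mod', Nat.mod_eq_of_lt a.2, le_refl]

end Mode

section Blocks

variable {m n M N K Nx : ℕ}

/-- The space-time operator with a given matrix of spatial blocks; it is `block` on matrices, so
that products of block matrices can be formed before flattening. -/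
def ofBlocks (X : Matrix (Fin N) (Fin M) (Matrix (Fin Nx) (Fin Nx) ℂ)) : Op N M Nx := block X

theorem ofBlocks_apply (X : Matrix (Fin N) (Fin M) (Matrix (Fin Nx) (Fin Nx) ℂ))
    (p : Fin N × Fin Nx) (q : Fin M × Fin Nx) : ofBlocks X p q = X p.1 q.1 p.2 q.2 := rfl

theorem ofBlocks_zero :
    ofBlocks (0 : Matrix (Fin N) (Fin M) (Matrix (Fin Nx) (Fin Nx) ℂ)) = 0 := rfl

theorem ofBlocks_add (X Y : Matrix (Fin N) (Fin M) (Matrix (Fin Nx) (Fin Nx) ℂ)) :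
    ofBlocks (X + Y) = ofBlocks X + ofBlocks Y := rfl

theorem ofBlocks_sub (X Y : Matrix (Fin N) (Fin M) (Matrix (Fin Nx) (Fin Nx) ℂ)) :
    ofBlocks (X - Y) = ofBlocks X - ofBlocks Y := rfl

theorem ofBlocks_diagonal (W : Matrix (Fin Nx) (Fin Nx) ℂ) :
    ofBlocks (Matrix.diagonal fun _ => W) = (1 : Matrix (Fin N) (Fin N) ℂ) ⊗ₖ W := by
  ext p q
  rcases eq_or_ne p.1 q.1 with h | h <;> simp [ofBlocks_apply, Matrix.one_apply, h]

theorem ofBlocks_one :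
    ofBlocks (1 : Matrix (Fin N) (Fin N) (Matrix (Fin Nx) (Fin Nx) ℂ)) = 1 := by
  rw [← Matrix.one_kronecker_one, ← ofBlocks_diagonal, Matrix.diagonal_one]

theorem ofBlocks_mul (X : Matrix (Fin N) (Fin M) (Matrix (Fin Nx) (Fin Nx) ℂ))
    (Y : Matrix (Fin M) (Fin K) (Matrix (Fin Nx) (Fin Nx) ℂ)) :
    ofBlocks (X * Y) = ofBlocks X * ofBlocks Y := by
  ext p q
  simp only [ofBlocks_apply, Matrix.mul_apply, Matrix.sum_apply, Fintype.sum_prod_type]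

theorem timeMat_eq_ofBlocks (Φ : Matrix (Fin Nx) (Fin Nx) ℂ) :
    timeMat N Φ = ofBlocks (stepMat N Φ) := by
  refine congrArg block (funext₂ fun i j => ?_)
  rw [stepMat, Matrix.sub_apply, subdiag, Matrix.of_apply, Matrix.one_apply]
  by_cases hij : i = j
  · simp [hij]
  · split_ifs <;> simp

theorem idealRestrict_eq_ofBlocks (Φ : Matrix (Fin Nx) (Fin Nx) ℂ) :
    idealRestrict m (n * m + 1) (n + 1) Φ = ofBlocks (restrictMat m n Φ) := rfl

theorem timeMat_inv (Φ : Matrix (Fin Nx) (Fin Nx) ℂ) :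
    (timeMat N Φ)⁻¹ = ofBlocks (stepInv N Φ) :=
  Matrix.inv_eq_right_inv <| by
    rw [timeMat_eq_ofBlocks, ← ofBlocks_mul, stepMat_mul_stepInv, ofBlocks_one]

theorem injRestrict_eq_ofBlocks :
    injRestrict m (n * m + 1) (n + 1) Nx = ofBlocks (injMat _ m n) := by
  refine congrArg block (funext₂ fun p i => ?_)
  simp only [injMat, Matrix.submatrix_apply, id_eq, Matrix.one_apply, Fin.ext_iff, coarsePoint,
    eq_comm]

theorem injRestrict_transpose_eq_ofBlocks :
    (injRestrict m (n * m + 1) (n + 1) Nx)ᵀ = ofBlocks (injMat _ m n)ᵀ := by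
  rw [injRestrict_eq_ofBlocks]
  ext p q
  simp only [Matrix.transpose_apply, ofBlocks_apply, injMat, Matrix.submatrix_apply, id_eq,
    Matrix.one_apply]
  split_ifs
  · exact congrFun₂ Matrix.transpose_one p.2 q.2
  · rfl

theorem injRestrict_eq_submatrix :
    injRestrict m (n * m + 1) (n + 1) Nx =
      (1 : Op _ _ Nx).submatrix (Prod.map (coarsePoint m) id) id := by
  rw [injRestrict_eq_ofBlocks, ← ofBlocks_one]
  rfl

theorem injRestrict_apply_eq_zero_of_not_dvd (p : Fin M × Fin Nx) {q : Fin N × Fin Nx}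
    (hq : ¬ m ∣ (q.1 : ℕ)) : injRestrict m N M Nx p q = 0 := by
  have hqp : (q.1 : ℕ) ≠ p.1 * m := fun h => hq (h ▸ dvd_mul_left _ _)
  simp [injRestrict, block, hqp]

variable [NeZero m]

theorem idealInterp_eq_ofBlocks (Φ : Matrix (Fin Nx) (Fin Nx) ℂ) :
    idealInterp m (n * m + 1) (n + 1) Φ = ofBlocks (interpMat m n Φ) := by
  refine congrArg block (funext₂ fun i q => ?_)
  have hi := Nat.div_add_mod' i m
  have hiff : (q : ℕ) * m ≤ i ∧ (i : ℕ) < q * m + m ↔ (q : ℕ) = i / m := by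
    rw [eq_comm, Nat.div_eq_iff (NeZero.pos m)]
    have := NeZero.pos m
    omega
  simp only [interpMat, intervalMat, Matrix.transpose_apply, Matrix.of_apply, Fin.ext_iff, interval,
    hiff]
  refine ite_congr rfl (fun hq => ?_) fun _ => rfl
  rw [hq, show (i : ℕ) - i / m * m = i % m by omega]

theorem injRestrict_transpose_mul_self :
    (injRestrict m (n * m + 1) (n + 1) Nx)ᵀ * injRestrict m (n * m + 1) (n + 1) Nx =
      Matrix.diagonal fun p => if m ∣ (p.1 : ℕ) then 1 else 0 := by
  ext p q
  rw [Matrix.mul_apply, Matrix.diagonal_apply]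
  by_cases hp : m ∣ (p.1 : ℕ)
  · have hp' : Prod.map (coarsePoint m) id (interval p.1, p.2) = p :=
      Prod.ext (coarsePoint_eq_iff.2 ⟨rfl, Nat.mod_eq_zero_of_dvd hp⟩) rfl
    rw [Fintype.sum_eq_single (interval p.1, p.2), if_pos hp, injRestrict_eq_submatrix,
      Matrix.transpose_apply, Matrix.submatrix_apply, Matrix.submatrix_apply, hp']
    · simp [Matrix.one_apply]
    · intro x hx
      rw [injRestrict_eq_submatrix, Matrix.transpose_apply, Matrix.submatrix_apply,
        Matrix.one_apply_ne, zero_mul]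
      rintro rfl
      exact hx (Prod.ext (interval_coarsePoint x.1).symm rfl)
  · rw [if_neg hp, ite_self]
    refine Finset.sum_eq_zero fun x _ => ?_
    rw [Matrix.transpose_apply, injRestrict_apply_eq_zero_of_not_dvd x hp, zero_mul]

end Blocks

section FPoints

variable {m n N Nx : ℕ}

theorem mul_fEmbed {κ : Type*} (X : Matrix κ (Fin N × Fin Nx) ℂ) :
    X * fEmbed m N Nx = X.submatrix id (Prod.map Subtype.val id) := by
  ext p q
  simp [fEmbed, Matrix.mul_apply, ← Prod.mk_inj, Prod.map]

theorem injRestrict_mul_fEmbed (M : ℕ) : injRestrict m N M Nx * fEmbed m N Nx = 0 := by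
  rw [mul_fEmbed]
  ext p q
  exact injRestrict_apply_eq_zero_of_not_dvd p q.1.2

theorem fEmbed_transpose_mul_self : (fEmbed m N Nx)ᵀ * fEmbed m N Nx = 1 := by
  rw [mul_fEmbed]
  ext p q
  simp [fEmbed, Matrix.one_apply, Prod.ext_iff, Subtype.ext_iff, eq_comm]

theorem fEmbed_mul_transpose_self :
    fEmbed m N Nx * (fEmbed m N Nx)ᵀ =
      Matrix.diagonal fun p => if m ∣ (p.1 : ℕ) then 0 else 1 := by
  ext p q
  rw [Matrix.mul_apply, Matrix.diagonal_apply]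
  by_cases hp : m ∣ (p.1 : ℕ)
  · rw [if_pos hp, ite_self]
    refine Finset.sum_eq_zero fun x _ => ?_
    rw [fEmbed, Matrix.of_apply, if_neg, zero_mul]
    exact fun h => x.1.2 (h.1 ▸ hp)
  · rw [Fintype.sum_eq_single (⟨p.1, hp⟩, p.2), if_neg hp]
    · simp [fEmbed, Prod.ext_iff, eq_comm]
    · intro x hx
      rw [fEmbed, Matrix.of_apply, if_neg, zero_mul]
      exact fun h => hx (Prod.ext (Subtype.ext h.1.symm) h.2.symm)

theorem fEmbed_mul_transpose_self_eq_one_sub [NeZero m] :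
    fEmbed m (n * m + 1) Nx * (fEmbed m (n * m + 1) Nx)ᵀ =
      1 - (injRestrict m (n * m + 1) (n + 1) Nx)ᵀ * injRestrict m (n * m + 1) (n + 1) Nx := by
  rw [fEmbed_mul_transpose_self, injRestrict_transpose_mul_self, ← Matrix.diagonal_one,
    Matrix.diagonal_sub]
  congr 1
  ext p
  split_ifs <;> simp

theorem timeMat_mul_ofBlocks_fSolveMat [NeZero m] (Φ : Matrix (Fin Nx) (Fin Nx) ℂ) :
    timeMat (n * m + 1) Φ * ofBlocks (fSolveMat m n Φ) =
      1 - (injRestrict m (n * m + 1) (n + 1) Nx)ᵀ *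
        idealRestrict m (n * m + 1) (n + 1) Φ := by
  rw [timeMat_eq_ofBlocks, ← ofBlocks_mul, stepMat_mul_fSolveMat, ofBlocks_sub, ofBlocks_one,
    ofBlocks_mul, injRestrict_transpose_eq_ofBlocks, idealRestrict_eq_ofBlocks]

theorem fSolve_eq_ofBlocks [NeZero m] (Φ : Matrix (Fin Nx) (Fin Nx) ℂ) :
    fSolve m (n * m + 1) Φ = ofBlocks (fSolveMat m n Φ) := by
  set S := fEmbed m (n * m + 1) Nx
  set F := ofBlocks (fSolveMat m n Φ)
  have hJF : injRestrict m (n * m + 1) (n + 1) Nx * F = 0 := by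
    rw [injRestrict_eq_ofBlocks, ← ofBlocks_mul, injMat_mul_fSolveMat, ofBlocks_zero]
  have hFJ : F * (injRestrict m (n * m + 1) (n + 1) Nx)ᵀ = 0 := by
    rw [injRestrict_transpose_eq_ofBlocks, ← ofBlocks_mul, fSolveMat_mul_injMat_transpose,
      ofBlocks_zero]
  have hSJ : Sᵀ * (injRestrict m (n * m + 1) (n + 1) Nx)ᵀ = 0 := by
    rw [← Matrix.transpose_mul, injRestrict_mul_fEmbed, Matrix.transpose_zero]
  have hSF : S * Sᵀ * F = F := by
    rw [fEmbed_mul_transpose_self_eq_one_sub, Matrix.sub_mul, Matrix.one_mul, Matrix.mul_assoc,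
      hJF, Matrix.mul_zero, sub_zero]
  have hFS : F * (S * Sᵀ) = F := by
    rw [fEmbed_mul_transpose_self_eq_one_sub, Matrix.mul_sub, Matrix.mul_one, ← Matrix.mul_assoc,
      hFJ, Matrix.zero_mul, sub_zero]
  have hinv : (Sᵀ * timeMat (n * m + 1) Φ * S) * (Sᵀ * F * S) = 1 := by
    calc (Sᵀ * timeMat (n * m + 1) Φ * S) * (Sᵀ * F * S)
        = Sᵀ * (timeMat (n * m + 1) Φ * (S * Sᵀ * F)) * S := by simp only [Matrix.mul_assoc]
      _ = 1 := by
        rw [hSF, timeMat_mul_ofBlocks_fSolveMat, Matrix.mul_sub, ← Matrix.mul_assoc, hSJ,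
          Matrix.zero_mul, sub_zero, Matrix.mul_one, fEmbed_transpose_mul_self]
  calc fSolve m (n * m + 1) Φ = S * (Sᵀ * F * S) * Sᵀ := by
        rw [fSolve, Matrix.inv_eq_right_inv hinv]
    _ = S * Sᵀ * (F * (S * Sᵀ)) := by simp only [Matrix.mul_assoc]
    _ = F := by rw [hFS, hSF]

end FPoints

section Cycle

variable {m m₀ m₁ n Nx : ℕ} [NeZero m] [NeZero m₀] [NeZero m₁]

theorem injRestrict_mul_idealInterp (φ : Matrix (Fin Nx) (Fin Nx) ℂ) :
    injRestrict m (n * m + 1) (n + 1) Nx * idealInterp m (n * m + 1) (n + 1) φ = 1 := by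
  rw [injRestrict_eq_ofBlocks, idealInterp_eq_ofBlocks, ← ofBlocks_mul, injMat_mul_interpMat,
    ofBlocks_one]

theorem idealRestrict_mul_injRestrict_transpose (φ : Matrix (Fin Nx) (Fin Nx) ℂ) :
    idealRestrict m (n * m + 1) (n + 1) φ * (injRestrict m (n * m + 1) (n + 1) Nx)ᵀ = 1 := by
  rw [injRestrict_transpose_eq_ofBlocks, idealRestrict_eq_ofBlocks, ← ofBlocks_mul,
    restrictMat_mul_injMat_transpose, ofBlocks_one]

theorem timeMat_mul_idealInterp (φ : Matrix (Fin Nx) (Fin Nx) ℂ) :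
    timeMat (n * m + 1) φ * idealInterp m (n * m + 1) (n + 1) φ =
      (injRestrict m (n * m + 1) (n + 1) Nx)ᵀ * timeMat (n + 1) (φ ^ m) := by
  rw [timeMat_eq_ofBlocks, idealInterp_eq_ofBlocks, ← ofBlocks_mul, stepMat_mul_interpMat,
    ofBlocks_mul, injRestrict_transpose_eq_ofBlocks, timeMat_eq_ofBlocks]

theorem timeMat_mul_fSolve (φ : Matrix (Fin Nx) (Fin Nx) ℂ) :
    timeMat (n * m + 1) φ * fSolve m (n * m + 1) φ =
      1 - (injRestrict m (n * m + 1) (n + 1) Nx)ᵀ * idealRestrict m (n * m + 1) (n + 1) φ := by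
  rw [fSolve_eq_ofBlocks, timeMat_mul_ofBlocks_fSolveMat]

theorem ofBlocks_coarseSolve (φ ψ : Matrix (Fin Nx) (Fin Nx) ℂ) :
    ofBlocks (coarseSolve m n φ ψ) =
      idealInterp m (n * m + 1) (n + 1) φ * (timeMat (n + 1) ψ)⁻¹ *
        idealRestrict m (n * m + 1) (n + 1) φ + fSolve m (n * m + 1) φ := by
  rw [coarseSolve, ofBlocks_add, ofBlocks_mul, ofBlocks_mul, idealInterp_eq_ofBlocks, timeMat_inv,
    idealRestrict_eq_ofBlocks, fSolve_eq_ofBlocks]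

theorem errPropCoarse_eq_ofBlocks (Φ : Fin 3 → Matrix (Fin Nx) (Fin Nx) ℂ) :
    errPropCoarse m₀ m₁ (n * m₁ * m₀ + 1) (n * m₁ + 1) (n + 1) Φ =
      ofBlocks (errMat m₁ n (Φ 0 ^ m₀) (Φ 1) (Φ 2)) := by
  have hJP := injRestrict_mul_idealInterp (m := m₀) (n := n * m₁) (Φ 0)
  have hRAP : idealRestrict m₀ (n * m₁ * m₀ + 1) (n * m₁ + 1) (Φ 0) *
      (timeMat (n * m₁ * m₀ + 1) (Φ 0) * idealInterp m₀ (n * m₁ * m₀ + 1) (n * m₁ + 1) (Φ 0)) =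
      timeMat (n * m₁ + 1) (Φ 0 ^ m₀) := by
    rw [timeMat_mul_idealInterp, ← Matrix.mul_assoc, idealRestrict_mul_injRestrict_transpose,
      Matrix.one_mul]
  set J := injRestrict m₀ (n * m₁ * m₀ + 1) (n * m₁ + 1) Nx
  set P := idealInterp m₀ (n * m₁ * m₀ + 1) (n * m₁ + 1) (Φ 0)
  calc errPropCoarse m₀ m₁ (n * m₁ * m₀ + 1) (n * m₁ + 1) (n + 1) Φ
      = J * P * (1 - ofBlocks (coarseSolve m₁ n (Φ 1) (Φ 2)) *
          (idealRestrict m₀ (n * m₁ * m₀ + 1) (n * m₁ + 1) (Φ 0) *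
            (timeMat (n * m₁ * m₀ + 1) (Φ 0) * P))) * (J * P) := by
        simp only [errPropCoarse, errProp, ofBlocks_coarseSolve, Matrix.mul_sub, Matrix.sub_mul,
          Matrix.mul_add, Matrix.add_mul, Matrix.mul_assoc, Matrix.one_mul, sub_sub, J, P]
    _ = ofBlocks (errMat m₁ n (Φ 0 ^ m₀) (Φ 1) (Φ 2)) := by
        rw [hJP, hRAP, Matrix.one_mul, Matrix.mul_one, errMat, ofBlocks_sub, ofBlocks_one,
          ofBlocks_mul, timeMat_eq_ofBlocks]

theorem residual_add {N : ℕ} (φ : Matrix (Fin Nx) (Fin Nx) ℂ) (g u v : Vec N Nx) :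
    residual φ g (u + v) = residual φ g u - timeMat N φ *ᵥ v := by
  rw [residual, residual, Matrix.mulVec_add, sub_sub]

theorem residual_fRelax (φ : Matrix (Fin Nx) (Fin Nx) ℂ) (g u : Vec (n * m + 1) Nx) :
    residual φ g (fRelax m φ g u) =
      (injRestrict m (n * m + 1) (n + 1) Nx)ᵀ *ᵥ
        (idealRestrict m (n * m + 1) (n + 1) φ *ᵥ residual φ g u) := by
  rw [fRelax, residual_add, Matrix.mulVec_mulVec, timeMat_mul_fSolve, Matrix.sub_mulVec,
    Matrix.one_mulVec, sub_sub_cancel, Matrix.mulVec_mulVec]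

theorem idealRestrict_mulVec_residual_fRelax (φ : Matrix (Fin Nx) (Fin Nx) ℂ)
    (g u : Vec (n * m + 1) Nx) :
    idealRestrict m (n * m + 1) (n + 1) φ *ᵥ residual φ g (fRelax m φ g u) =
      idealRestrict m (n * m + 1) (n + 1) φ *ᵥ residual φ g u := by
  rw [residual_fRelax, Matrix.mulVec_mulVec, idealRestrict_mul_injRestrict_transpose,
    Matrix.one_mulVec]

theorem levelOneCycle_eq_ofBlocks_mulVec (Φ : Fin 3 → Matrix (Fin Nx) (Fin Nx) ℂ)
    (g : Vec (n * m₁ + 1) Nx) :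
    levelOneCycle m₁ (n * m₁ + 1) (n + 1) Φ g =
      ofBlocks (coarseSolve m₁ n (Φ 1) (Φ 2)) *ᵥ g := by
  have hres : residual (Φ 1) g 0 = g := by rw [residual, Matrix.mulVec_zero, sub_zero]
  rw [levelOneCycle, idealRestrict_mulVec_residual_fRelax, fRelax, hres, zero_add,
    ofBlocks_coarseSolve, Matrix.add_mulVec, add_comm (fSolve _ _ _ *ᵥ g), Matrix.mulVec_mulVec,
    Matrix.mulVec_mulVec, Matrix.mul_assoc]

theorem residual_vCycle (Φ : Fin 3 → Matrix (Fin Nx) (Fin Nx) ℂ)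
    (g u : Vec (n * m₁ * m₀ + 1) Nx) :
    residual (Φ 0) g (vCycle m₀ m₁ (n * m₁ * m₀ + 1) (n * m₁ + 1) (n + 1) Φ g u) =
      (injRestrict m₀ (n * m₁ * m₀ + 1) (n * m₁ + 1) Nx)ᵀ *ᵥ
        (ofBlocks (resMat m₁ n (Φ 0 ^ m₀) (Φ 1) (Φ 2)) *ᵥ
          (idealRestrict m₀ (n * m₁ * m₀ + 1) (n * m₁ + 1) (Φ 0) *ᵥ residual (Φ 0) g u)) := by
  rw [vCycle, residual_add, idealRestrict_mulVec_residual_fRelax, residual_fRelax,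
    levelOneCycle_eq_ofBlocks_mulVec, Matrix.mulVec_mulVec _ (timeMat _ _),
    timeMat_mul_idealInterp, ← Matrix.mulVec_mulVec, ← Matrix.mulVec_sub, resMat, ofBlocks_sub,
    ofBlocks_one, ofBlocks_mul, timeMat_eq_ofBlocks, Matrix.sub_mulVec, Matrix.one_mulVec,
    Matrix.mulVec_mulVec _ (ofBlocks (stepMat _ _))]

theorem eq_injRestrict_transpose_mulVec {r : Vec (n * m + 1) Nx}
    (hr : ∀ p : Fin (n * m + 1) × Fin Nx, ¬ m ∣ (p.1 : ℕ) → r p = 0) :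
    r = (injRestrict m (n * m + 1) (n + 1) Nx)ᵀ *ᵥ
      (injRestrict m (n * m + 1) (n + 1) Nx *ᵥ r) := by
  rw [Matrix.mulVec_mulVec, injRestrict_transpose_mul_self]
  ext p
  rw [Matrix.mulVec_diagonal]
  split_ifs with hp
  · rw [one_mul]
  · rw [hr p hp, mul_zero]

end Cycle

section Norms

variable {N M Nx : ℕ}

theorem normOne_transpose {ι : Type*} [Fintype ι] (A : Matrix ι ι ℂ) :
    normOne Aᵀ = normInf A := rfl

theorem normOne_antiTranspose (X : Matrix (Fin N) (Fin N) ℂ) :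
    normOne (antiTranspose X) = normInf X :=
  Fin.revPerm.iSup_congr fun j => (Equiv.sum_comp Fin.revPerm fun i => ‖X (Fin.rev j) i‖).symm

theorem sum_norm_col_le_normOne {ι : Type*} [Fintype ι] (A : Matrix ι ι ℂ) (j : ι) :
    ∑ i, ‖A i j‖ ≤ normOne A :=
  le_ciSup (f := fun j => ∑ i, ‖A i j‖) (Set.finite_range _).bddAbove j

theorem sum_norm_row_le_normInf {ι : Type*} [Fintype ι] (A : Matrix ι ι ℂ) (i : ι) :
    ∑ j, ‖A i j‖ ≤ normInf A :=
  sum_norm_col_le_normOne Aᵀ i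

theorem normInf_nonneg {ι : Type*} [Fintype ι] (A : Matrix ι ι ℂ) : 0 ≤ normInf A :=
  Real.iSup_nonneg fun _ => Finset.sum_nonneg fun _ _ => norm_nonneg _

theorem l2Norm_eq_sqrt_sum (r : Vec N Nx) : l2Norm r = √(∑ p, ‖r p‖ ^ 2) :=
  EuclideanSpace.norm_eq _

theorem l2Norm_eq_sqrt_dotProduct (r : Vec N Nx) : l2Norm r = √(star r ⬝ᵥ r).re := by
  rw [l2Norm_eq_sqrt_sum, dotProduct, Complex.re_sum]
  congr! with p
  rw [Pi.star_apply, RCLike.star_def, Complex.conj_mul', ← Complex.ofReal_pow, Complex.ofReal_re]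

theorem l2Norm_mulVec_of_conjTranspose_mul_self_eq_one {V : Op N M Nx} (hV : Vᴴ * V = 1)
    (r : Vec M Nx) : l2Norm (V *ᵥ r) = l2Norm r := by
  rw [l2Norm_eq_sqrt_dotProduct, l2Norm_eq_sqrt_dotProduct, Matrix.star_mulVec,
    ← Matrix.dotProduct_mulVec, Matrix.mulVec_mulVec, hV, Matrix.one_mulVec]

theorem sq_norm_mulVec_apply_le (A : Op N M Nx) (v : Vec M Nx) (p : Fin N × Fin Nx) :
    ‖(A *ᵥ v) p‖ ^ 2 ≤ (∑ q, ‖A p q‖) * ∑ q, ‖A p q‖ * ‖v q‖ ^ 2 :=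
  calc ‖(A *ᵥ v) p‖ ^ 2 ≤ (∑ q, ‖A p q‖ * ‖v q‖) ^ 2 := by
        gcongr
        simp only [← norm_mul]
        exact norm_sum_le _ _
    _ ≤ (∑ q, ‖A p q‖) * ∑ q, ‖A p q‖ * ‖v q‖ ^ 2 :=
        Finset.sum_sq_le_sum_mul_sum_of_sq_le_mul _ (fun _ _ => norm_nonneg _)
          (fun _ _ => by positivity) fun _ _ => le_of_eq (by ring)

theorem l2Norm_mulVec_le_sqrt_normOne_mul_normInf (A : Op N N Nx) (v : Vec N Nx) :
    l2Norm (A *ᵥ v) ≤ √(normOne A * normInf A) * l2Norm v := by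
  rw [l2Norm_eq_sqrt_sum, l2Norm_eq_sqrt_sum, ← Real.sqrt_mul' _ (by positivity)]
  refine Real.sqrt_le_sqrt ?_
  calc ∑ p, ‖(A *ᵥ v) p‖ ^ 2
      ≤ ∑ p, normInf A * ∑ q, ‖A p q‖ * ‖v q‖ ^ 2 := by
        refine Finset.sum_le_sum fun p _ => (sq_norm_mulVec_apply_le A v p).trans ?_
        gcongr
        exact sum_norm_row_le_normInf A p
    _ = normInf A * ∑ q, (∑ p, ‖A p q‖) * ‖v q‖ ^ 2 := by
        rw [← Finset.mul_sum, Finset.sum_comm]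
        simp only [Finset.sum_mul]
    _ ≤ normInf A * ∑ q, normOne A * ‖v q‖ ^ 2 := by
        gcongr with q
        · exact normInf_nonneg A
        · exact sum_norm_col_le_normOne A q
    _ = normOne A * normInf A * ∑ q, ‖v q‖ ^ 2 := by
        rw [← Finset.mul_sum]
        ring

variable {U : Matrix (Fin Nx) (Fin Nx) ℂ}

theorem modNorm_eq_l2Norm (U : Matrix (Fin Nx) (Fin Nx) ℂ) (r : Vec N Nx) :
    modNorm U r = l2Norm (((1 : Matrix (Fin N) (Fin N) ℂ) ⊗ₖ U⁻¹) *ᵥ r) := by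
  rw [modNorm, Matrix.mul_inv_rev, ← Matrix.conjTranspose_nonsing_inv, Matrix.inv_kronecker,
    inv_one, l2Norm_eq_sqrt_dotProduct, Matrix.star_mulVec, ← Matrix.dotProduct_mulVec,
    Matrix.mulVec_mulVec]

theorem modNorm_of_mem_unitaryGroup (hU : U ∈ Matrix.unitaryGroup (Fin Nx) ℂ) :
    modNorm (N := N) U = l2Norm := by
  funext r
  have hV : ((1 : Matrix (Fin N) (Fin N) ℂ) ⊗ₖ U) * ((1 : Matrix (Fin N) (Fin N) ℂ) ⊗ₖ U)ᴴ = 1 := by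
    rw [Matrix.conjTranspose_kronecker, ← Matrix.mul_kronecker_mul, Matrix.conjTranspose_one,
      Matrix.one_mul, ← Matrix.star_eq_conjTranspose U, Matrix.mem_unitaryGroup_iff.1 hU,
      Matrix.one_kronecker_one]
  rw [modNorm, hV, inv_one, Matrix.one_mulVec, l2Norm_eq_sqrt_dotProduct]

theorem l2Norm_injRestrict_transpose_mulVec {m n : ℕ} [NeZero m] (s : Vec (n + 1) Nx) :
    l2Norm ((injRestrict m (n * m + 1) (n + 1) Nx)ᵀ *ᵥ s) = l2Norm s := by
  refine l2Norm_mulVec_of_conjTranspose_mul_self_eq_one ?_ s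
  rw [injRestrict_eq_submatrix, Matrix.transpose_submatrix, Matrix.transpose_one,
    Matrix.conjTranspose_submatrix, Matrix.conjTranspose_one,
    ← Matrix.submatrix_mul _ _ _ _ _ Function.bijective_id, Matrix.one_mul]
  exact Matrix.submatrix_one _ (coarsePoint_injective.prodMap Function.injective_id)

theorem modNorm_injRestrict_transpose_mulVec {m n : ℕ} [NeZero m]
    (U : Matrix (Fin Nx) (Fin Nx) ℂ) (s : Vec (n + 1) Nx) :
    modNorm U ((injRestrict m (n * m + 1) (n + 1) Nx)ᵀ *ᵥ s) = modNorm U s := by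
  have hcomm : ((1 : Matrix (Fin (n * m + 1)) (Fin (n * m + 1)) ℂ) ⊗ₖ U⁻¹) *
      (injRestrict m (n * m + 1) (n + 1) Nx)ᵀ =
      (injRestrict m (n * m + 1) (n + 1) Nx)ᵀ *
        ((1 : Matrix (Fin (n + 1)) (Fin (n + 1)) ℂ) ⊗ₖ U⁻¹) := by
    rw [injRestrict_transpose_eq_ofBlocks, ← ofBlocks_diagonal, ← ofBlocks_diagonal,
      ← ofBlocks_mul, ← ofBlocks_mul]
    congr 1
    ext1 i p
    rw [Matrix.diagonal_mul, Matrix.mul_diagonal, Matrix.transpose_apply, injMat,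
      Matrix.submatrix_apply, Matrix.one_apply]
    split_ifs
    · rw [one_mul, mul_one]
    · rw [zero_mul, mul_zero]
  rw [modNorm_eq_l2Norm, modNorm_eq_l2Norm, Matrix.mulVec_mulVec, hcomm, ← Matrix.mulVec_mulVec,
    l2Norm_injRestrict_transpose_mulVec]

end Norms

section Modes

variable {m m₀ m₁ n N M Nx : ℕ}

/-- The space-time operator, diagonal in space, whose `k`-th spatial mode evolves under the `k`-th
component of `X`. -/
def ofModes (X : Matrix (Fin N) (Fin M) (Fin Nx → ℂ)) : Op N M Nx :=
  ofBlocks (X.map (Matrix.diagonalRingHom (Fin Nx) ℂ))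

theorem ofModes_apply (X : Matrix (Fin N) (Fin M) (Fin Nx → ℂ)) (p : Fin N × Fin Nx)
    (q : Fin M × Fin Nx) : ofModes X p q = if p.2 = q.2 then X p.1 q.1 p.2 else 0 := rfl

theorem ofModes_transpose (X : Matrix (Fin N) (Fin M) (Fin Nx → ℂ)) :
    (ofModes X)ᵀ = ofModes Xᵀ := by
  ext p q
  rw [Matrix.transpose_apply, ofModes_apply, ofModes_apply, Matrix.transpose_apply]
  by_cases h : p.2 = q.2
  · rw [if_pos h.symm, if_pos h, h]
  · rw [if_neg (Ne.symm h), if_neg h]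

theorem normOne_ofModes (X : Matrix (Fin N) (Fin N) (Fin Nx → ℂ)) :
    normOne (ofModes X) = ⨆ k, normOne (X.map (Pi.evalRingHom _ k)) := by
  have hsum : ∀ q : Fin N × Fin Nx, ∑ p, ‖ofModes X p q‖ = ∑ i, ‖X i q.1 q.2‖ := fun q => by
    simp [Fintype.sum_prod_type, ofModes_apply, apply_ite]
  simp only [normOne, hsum]
  rw [← (Equiv.prodComm (Fin Nx) (Fin N)).iSup_comp, Finite.ciSup_prod]
  rfl

theorem normInf_ofModes (X : Matrix (Fin N) (Fin N) (Fin Nx → ℂ)) :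
    normInf (ofModes X) = ⨆ k, normInf (X.map (Pi.evalRingHom _ k)) := by
  rw [← normOne_transpose, ofModes_transpose, normOne_ofModes]
  rfl

theorem normOne_ofModes_antiTranspose (X : Matrix (Fin N) (Fin N) (Fin Nx → ℂ)) :
    normOne (ofModes (antiTranspose X)) = normInf (ofModes X) := by
  rw [normOne_ofModes, normInf_ofModes]
  exact iSup_congr fun k => normOne_antiTranspose (X.map (Pi.evalRingHom _ k))

theorem normInf_ofModes_antiTranspose (X : Matrix (Fin N) (Fin N) (Fin Nx → ℂ)) :
    normInf (ofModes (antiTranspose X)) = normOne (ofModes X) := by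
  rw [← normOne_ofModes_antiTranspose, antiTranspose_antiTranspose]

theorem errPropCoarse_diagonal [NeZero m₀] [NeZero m₁] (lam : Fin 3 → Fin Nx → ℂ) :
    errPropCoarse m₀ m₁ (n * m₁ * m₀ + 1) (n * m₁ + 1) (n + 1) (fun l => Matrix.diagonal (lam l)) =
      ofModes (errMat m₁ n (lam 0 ^ m₀) (lam 1) (lam 2)) := by
  rw [errPropCoarse_eq_ofBlocks, ofModes, map_errMat, map_pow]
  rfl

end Modes

section Convergence

variable {m m₀ m₁ n Nx : ℕ} {U : Matrix (Fin Nx) (Fin Nx) ℂ}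

theorem kronecker_mul_ofBlocks_resMat_conj (hU : IsUnit U) (w y z : Matrix (Fin Nx) (Fin Nx) ℂ) :
    ((1 : Matrix (Fin (n * m + 1)) (Fin (n * m + 1)) ℂ) ⊗ₖ U⁻¹) *
        ofBlocks (resMat m n (U * w * U⁻¹) (U * y * U⁻¹) (U * z * U⁻¹)) =
      ofBlocks (resMat m n w y z) *
        ((1 : Matrix (Fin (n * m + 1)) (Fin (n * m + 1)) ℂ) ⊗ₖ U⁻¹) := by
  obtain ⟨V, rfl⟩ := hU
  let f := MulSemiringAction.toRingHom (ConjAct (Matrix (Fin Nx) (Fin Nx) ℂ)ˣ)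
    (Matrix (Fin Nx) (Fin Nx) ℂ) (ConjAct.toConjAct V)
  have hf : ∀ x, f x = V * x * (V : Matrix (Fin Nx) (Fin Nx) ℂ)⁻¹ := fun x => by
    rw [← Matrix.coe_units_inv]
    rfl
  rw [← hf, ← hf, ← hf, ← map_resMat f, ← ofBlocks_diagonal, ← ofBlocks_mul, ← ofBlocks_mul]
  congr 1
  ext1 i j
  rw [Matrix.diagonal_mul, Matrix.mul_diagonal, Matrix.map_apply, hf, ← Matrix.coe_units_inv,
    mul_assoc, Units.inv_mul_cancel_left]

variable [NeZero m₀] [NeZero m₁] {Φ : Fin 3 → Matrix (Fin Nx) (Fin Nx) ℂ}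
  {lam : Fin 3 → Fin Nx → ℂ}

theorem modNorm_ofBlocks_resMat_mulVec_le (hU : IsUnit U)
    (hΦ : ∀ l, Φ l = U * Matrix.diagonal (lam l) * U⁻¹) (s : Vec (n * m₁ + 1) Nx) :
    let E := errPropCoarse m₀ m₁ (n * m₁ * m₀ + 1) (n * m₁ + 1) (n + 1)
      (fun l => Matrix.diagonal (lam l))
    modNorm U (ofBlocks (resMat m₁ n (Φ 0 ^ m₀) (Φ 1) (Φ 2)) *ᵥ s) ≤
      √(normOne E * normInf E) * modNorm U s := by
  intro E
  have hpow : Φ 0 ^ m₀ = U * Matrix.diagonal (lam 0 ^ m₀) * U⁻¹ := by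
    obtain ⟨V, rfl⟩ := hU
    rw [hΦ, ← Matrix.coe_units_inv, Units.conj_pow, Matrix.diagonal_pow]
  have hres : ofBlocks (resMat m₁ n (Matrix.diagonal (lam 0 ^ m₀)) (Matrix.diagonal (lam 1))
      (Matrix.diagonal (lam 2))) =
      ofModes (antiTranspose (errMat m₁ n (lam 0 ^ m₀) (lam 1) (lam 2))) := by
    rw [antiTranspose_errMat, ofModes, map_resMat]
    rfl
  have hE : E = ofModes (errMat m₁ n (lam 0 ^ m₀) (lam 1) (lam 2)) := errPropCoarse_diagonal lam
  rw [modNorm_eq_l2Norm, modNorm_eq_l2Norm, hpow, hΦ 1, hΦ 2, Matrix.mulVec_mulVec,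
    kronecker_mul_ofBlocks_resMat_conj hU, ← Matrix.mulVec_mulVec, hres, hE]
  refine (l2Norm_mulVec_le_sqrt_normOne_mul_normInf _ _).trans_eq ?_
  rw [normOne_ofModes_antiTranspose, normInf_ofModes_antiTranspose, mul_comm (normInf _)]

theorem modNorm_residual_vCycle_le (hU : IsUnit U)
    (hΦ : ∀ l, Φ l = U * Matrix.diagonal (lam l) * U⁻¹) (g : Vec (n * m₁ * m₀ + 1) Nx)
    {u : Vec (n * m₁ * m₀ + 1) Nx} {s : Vec (n * m₁ + 1) Nx}
    (hs : residual (Φ 0) g u = (injRestrict m₀ (n * m₁ * m₀ + 1) (n * m₁ + 1) Nx)ᵀ *ᵥ s) :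
    let E := errPropCoarse m₀ m₁ (n * m₁ * m₀ + 1) (n * m₁ + 1) (n + 1)
      (fun l => Matrix.diagonal (lam l))
    modNorm U (residual (Φ 0) g
        (vCycle m₀ m₁ (n * m₁ * m₀ + 1) (n * m₁ + 1) (n + 1) Φ g u)) ≤
      √(normOne E * normInf E) * modNorm U (residual (Φ 0) g u) := by
  intro E
  rw [residual_vCycle, hs, Matrix.mulVec_mulVec _ (idealRestrict _ _ _ _),
    idealRestrict_mul_injRestrict_transpose, Matrix.one_mulVec,
    modNorm_injRestrict_transpose_mulVec, modNorm_injRestrict_transpose_mulVec]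
  exact modNorm_ofBlocks_resMat_mulVec_le hU hΦ s

theorem convFactor_modNorm_le (hU : IsUnit U)
    (hΦ : ∀ l, Φ l = U * Matrix.diagonal (lam l) * U⁻¹) {g u : Vec (n * m₁ * m₀ + 1) Nx}
    (hu : ∃ s, residual (Φ 0) g u =
      (injRestrict m₀ (n * m₁ * m₀ + 1) (n * m₁ + 1) Nx)ᵀ *ᵥ s) :
    let E := errPropCoarse m₀ m₁ (n * m₁ * m₀ + 1) (n * m₁ + 1) (n + 1)
      (fun l => Matrix.diagonal (lam l))
    convFactor m₀ m₁ (n * m₁ * m₀ + 1) (n * m₁ + 1) (n + 1) Φ (modNorm U) g u ≤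
      ENNReal.ofReal √(normOne E * normInf E) := by
  intro E
  refine iSup_le fun i => ENNReal.div_le_of_le_mul ?_
  obtain ⟨s, hs⟩ : ∃ s, residual (Φ 0) g
      ((vCycle m₀ m₁ (n * m₁ * m₀ + 1) (n * m₁ + 1) (n + 1) Φ g)^[i] u) =
      (injRestrict m₀ (n * m₁ * m₀ + 1) (n * m₁ + 1) Nx)ᵀ *ᵥ s := by
    cases i with
    | zero => exact hu
    | succ i =>
      rw [Function.iterate_succ_apply']
      exact ⟨_, residual_vCycle Φ g _⟩
  rw [← ENNReal.ofReal_mul (Real.sqrt_nonneg _), Function.iterate_succ_apply']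
  exact ENNReal.ofReal_le_ofReal (modNorm_residual_vCycle_le hU hΦ g hs)

theorem normOne_errPropCoarse (hn : n ≠ 0) (hlam₁ : ∀ k, ‖lam 1 k‖ ≠ 1)
    (hlam₂ : ∀ k, ‖lam 2 k‖ ≠ 1) :
    normOne (errPropCoarse m₀ m₁ (n * m₁ * m₀ + 1) (n * m₁ + 1) (n + 1)
        (fun l => Matrix.diagonal (lam l))) =
      ⨆ k, ⨆ j : Fin m₁, colSum m₀ m₁ (n + 1) (lam 0 k) (lam 1 k) (lam 2 k) j := by
  rw [errPropCoarse_diagonal, normOne_ofModes]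
  refine iSup_congr fun k => ?_
  rw [map_errMat, map_pow]
  exact normOne_errMat (hlam₁ k) (hlam₂ k) hn

theorem normInf_errPropCoarse (hn : n ≠ 0) (hlam₁ : ∀ k, ‖lam 1 k‖ ≠ 1)
    (hlam₂ : ∀ k, ‖lam 2 k‖ ≠ 1) :
    normInf (errPropCoarse m₀ m₁ (n * m₁ * m₀ + 1) (n * m₁ + 1) (n + 1)
        (fun l => Matrix.diagonal (lam l))) =
      ⨆ k, ⨆ j : Fin m₁, rowSum m₀ m₁ (n + 1) (lam 0 k) (lam 1 k) (lam 2 k) j := by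
  rw [errPropCoarse_diagonal, normInf_ofModes]
  refine iSup_congr fun k => ?_
  rw [map_errMat, map_pow]
  exact normInf_errMat (hlam₁ k) (hlam₂ k) hn

end Convergence

end MGRIT

open MGRIT in
theorem mainTheorem4_general (Nx m₀ m₁ N₀ N₁ N₂ : ℕ) (hm₀ : 1 ≤ m₀) (hm₁ : 1 ≤ m₁)
    (hN₂ : 2 ≤ N₂) (hN₁ : N₁ = (N₂ - 1) * m₁ + 1) (hN₀ : N₀ = (N₁ - 1) * m₀ + 1)
    (Φ : Fin 3 → Matrix (Fin Nx) (Fin Nx) ℂ)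
    (U : Matrix (Fin Nx) (Fin Nx) ℂ) (lam : Fin 3 → Fin Nx → ℂ)
    (hU : IsUnit U) (hΦ : ∀ l, Φ l = U * Matrix.diagonal (lam l) * U⁻¹)
    (hlam₁ : ∀ k, ‖lam 1 k‖ ≠ 1) (hlam₂ : ∀ k, ‖lam 2 k‖ ≠ 1) :
    let E : Op N₁ N₁ Nx := errPropCoarse m₀ m₁ N₀ N₁ N₂ (fun l => Matrix.diagonal (lam l))
    (∀ g u : Vec N₀ Nx,
      ((∀ p : Fin N₀ × Fin Nx, ¬ m₀ ∣ (p.1 : ℕ) → residual (Φ 0) g u p = 0) ∨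
        (∃ v, u = vCycle m₀ m₁ N₀ N₁ N₂ Φ g v)) →
      convFactor m₀ m₁ N₀ N₁ N₂ Φ (modNorm U) g u ≤ ENNReal.ofReal √(normOne E * normInf E) ∧
        (U ∈ Matrix.unitaryGroup (Fin Nx) ℂ →
          convFactor m₀ m₁ N₀ N₁ N₂ Φ l2Norm g u ≤ ENNReal.ofReal √(normOne E * normInf E))) ∧
    normOne E =
      (⨆ k : Fin Nx, ⨆ j : Fin m₁, colSum m₀ m₁ N₂ (lam 0 k) (lam 1 k) (lam 2 k) j) ∧
    normInf E =
      (⨆ k : Fin Nx, ⨆ j : Fin m₁, rowSum m₀ m₁ N₂ (lam 0 k) (lam 1 k) (lam 2 k) j) := by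
  obtain ⟨n, rfl⟩ : ∃ n, N₂ = n + 1 := ⟨N₂ - 1, by omega⟩
  obtain rfl : N₁ = n * m₁ + 1 := hN₁
  obtain rfl : N₀ = n * m₁ * m₀ + 1 := hN₀
  have : NeZero m₀ := ⟨by omega⟩
  have : NeZero m₁ := ⟨by omega⟩
  have hn : n ≠ 0 := by omega
  intro E
  refine ⟨fun g u hu => ?_, normOne_errPropCoarse hn hlam₁ hlam₂,
    normInf_errPropCoarse hn hlam₁ hlam₂⟩
  have hs : ∃ s, residual (Φ 0) g u =
      (injRestrict m₀ (n * m₁ * m₀ + 1) (n * m₁ + 1) Nx)ᵀ *ᵥ s := by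
    rcases hu with hu | ⟨v, rfl⟩
    · exact ⟨_, eq_injRestrict_transpose_mulVec hu⟩
    · exact ⟨_, residual_vCycle Φ g v⟩
  have hle := convFactor_modNorm_le hU hΦ hs
  exact ⟨hle, fun hunit => modNorm_of_mem_unitaryGroup hunit ▸ hle⟩

theorem mainTheorem4 (Nx m₀ m₁ N₀ N₁ N₂ : ℕ) (hNx : 1 ≤ Nx) (hm₀ : 1 ≤ m₀) (hm₁ : 1 ≤ m₁)
    (hN₂ : 2 ≤ N₂) (hN₁ : N₁ = (N₂ - 1) * m₁ + 1) (hN₀ : N₀ = (N₁ - 1) * m₀ + 1)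
    (Φ : Fin 3 → Matrix (Fin Nx) (Fin Nx) ℂ)
    (U : Matrix (Fin Nx) (Fin Nx) ℂ) (lam : Fin 3 → Fin Nx → ℂ)
    (hU : IsUnit U) (hΦ : ∀ l, Φ l = U * Matrix.diagonal (lam l) * U⁻¹)
    (hlam : ∀ l k, ‖lam l k‖ < 1) :
    let E : MGRIT.Op N₁ N₁ Nx :=
      MGRIT.errPropCoarse m₀ m₁ N₀ N₁ N₂ (fun l => Matrix.diagonal (lam l))
    (∀ g u : MGRIT.Vec N₀ Nx,
      ((∀ p : Fin N₀ × Fin Nx, ¬ m₀ ∣ (p.1 : ℕ) → MGRIT.residual (Φ 0) g u p = 0) ∨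
        (∃ v, u = MGRIT.vCycle m₀ m₁ N₀ N₁ N₂ Φ g v)) →
      MGRIT.convFactor m₀ m₁ N₀ N₁ N₂ Φ (MGRIT.modNorm U) g u
          ≤ ENNReal.ofReal √(MGRIT.normOne E * MGRIT.normInf E) ∧
        (U ∈ Matrix.unitaryGroup (Fin Nx) ℂ →
          MGRIT.convFactor m₀ m₁ N₀ N₁ N₂ Φ MGRIT.l2Norm g u
            ≤ ENNReal.ofReal √(MGRIT.normOne E * MGRIT.normInf E))) ∧
    MGRIT.normOne E =
      (⨆ k : Fin Nx, ⨆ j : Fin m₁, MGRIT.colSum m₀ m₁ N₂ (lam 0 k) (lam 1 k) (lam 2 k) j) ∧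
    MGRIT.normInf E =
      (⨆ k : Fin Nx, ⨆ j : Fin m₁, MGRIT.rowSum m₀ m₁ N₂ (lam 0 k) (lam 1 k) (lam 2 k) j) := by
  exact mainTheorem4_general Nx m₀ m₁ N₀ N₁ N₂ hm₀ hm₁ hN₂ hN₁ hN₀ Φ U lam hU hΦ
    (fun k => (hlam 1 k).ne) fun k => (hlam 2 k).ne
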